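/- Manifolds are smooth Banach manifolds without boundary and everything is of class $C^\infty$. Let $\pi:E\to M$ be a smooth vector bundle. For a smooth vector bundle $\tau:P\to N$ let $\tau_1:J^1\tau\to N$ be the vector bundle of 1-jets of local sections of $\tau$ (with $j^1_n\sigma+j^1_n\eta=j^1_n(\sigma+\eta)$, $\lambda j^1_n\sigma=j^1_n(\lambda\sigma)$), and let $\tau_{10}:J^1\tau\to P$, $j^1_n\sigma\mapsto\sigma(n)$. A (nonlinear) connection on $\tau$ is a smooth section $h$ of $\tau_{10}$; its horizontal lift is $\xi^{h}(p,v)=h(p)(v)$, where $j^1_n\sigma(v)=T_n\sigma(v)$; it is linear if $h$ is a vector bundle morphism from $\tau$ to $\tau_1$. Let $\pi^*E=\{(a,b)\in E\times E\mid\pi(a)=\pi(b)\}$, with the vector bundle projection $\pi^*\pi:\pi^*E\to E$, $(a,b)\mapsto a$, and identify $T(\pi^*E)$ with the set of pairs $(w_1,w_2)\in TE\times TE$ such that $T\pi(w_1)=T\pi(w_2)$. A local section $\sigma$ of $\pi$ gives the section $\iota(\sigma)(a)=(a,\sigma(\pi(a)))$ of $\pi^*\pi$. Let $\Upsilon:\pi^*(J^1\pi)\to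 J^1(\pi^*\pi)$, $\Upsilon(a,j^1_m\sigma)=j^1_a(\iota(\sigma))$ for $m=\pi(a)$, and $\Psi:\pi_1^*(J^1\pi)\to J^1(\pi^*\pi)$, $\Psi(j^1_m\sigma,j^1_m\eta)=\Upsilon(\sigma(m),j^1_m\eta)$. For a connection $h$ on $\pi$ let $\mathcal Fh:\pi^*E\to\pi_1^*(J^1\pi)$ be its fibre derivative, $\mathcal Fh(a,b)=\bigl(h(a),\lim_{s\to0}\tfrac1s[h(a+sb)-h(a)]\bigr)$, the limit being taken in the fibre of $\pi_1$ over $\pi(a)$. The linearization of $h$ is the connection on $\pi^*\pi$ with horizontal lift $((a,b),w)\mapsto(w,B(a,b)w)$ for $w\in T_aE$, where $$B(a,b)w=\nu_{T\pi}\Bigl(\tfrac{d}{ds}\Big|_{s=0}\xi^{h}(a+sb,T\pi(w))\Bigr)\in T_bE .$$ Here $+_\tau,\cdot_\tau$ are the operations of the vector bundle $T\pi:TE\to TM$ (the differentials of those of $\pi$), and $\nu_{T\pi}$ is defined on $T\pi$-vertical vectors by $\nu_{T\pi}\bigl(\tfrac{d}{ds}|_{s=0}(v+_\tau s\cdot_\tau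 w')\bigr)=w'$ for $v,w'\in TE$ with $T\pi(v)=T\pi(w')$. **Theorem 7.2.** Let $h$ be a connection on $\pi:E\to M$. Then $\bar h=\Psi\circ\mathcal Fh$ is a smooth section of $(\pi^*\pi)_{10}:J^1(\pi^*\pi)\to\pi^*E$, and it is the section corresponding to the linearization of $h$, that is, $\bar h(a,b)(w)=(w,B(a,b)w)$ for all $(a,b)\in\pi^*E$ and $w\in T_aE$. Moreover the connection $\bar h$ is linear. -/

import Mathlib

open Bundle Filter Topology Set
open scoped Manifold ContDiff

noncomputable section

set_option linter.unusedSectionVars false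

namespace NonlinearConnection

lemma tangentMap_congr {E₁ H₁ M₁ E₂ H₂ M₂ : Type*} [NormedAddCommGroup E₁] [NormedSpace ℝ E₁]
    [TopologicalSpace H₁] {I₁ : ModelWithCorners ℝ E₁ H₁} [TopologicalSpace M₁] [ChartedSpace H₁ M₁]
    [NormedAddCommGroup E₂] [NormedSpace ℝ E₂] [TopologicalSpace H₂]
    {I₂ : ModelWithCorners ℝ E₂ H₂} [TopologicalSpace M₂] [ChartedSpace H₂ M₂]
    {f g : M₁ → M₂} {m : M₁} (h : f =ᶠ[𝓝 m] g) (v : TangentSpace I₁ m) :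
    tangentMap I₁ I₂ f ⟨m, v⟩ = tangentMap I₁ I₂ g ⟨m, v⟩ :=
  congrArg₂ (fun (b : M₂) (x : E₂) => (⟨b, x⟩ : TangentBundle I₂ M₂)) h.eq_of_nhds
    (DFunLike.congr_fun h.mfderiv_eq v)

/-! ## First jets of sections of a smooth Banach vector bundle

`M` is a manifold without boundary modelled on the Banach space `EM`; the vector bundle
`π : TotalSpace F V → M` has fibres `V m` and model fibre `F`.  The total space is a manifold with
model `I.prod 𝓘(ℝ, F)`. -/

section Jets

variable {EM : Type*} [NormedAddCommGroup EM] [NormedSpace ℝ EM]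
  {HM : Type*} [TopologicalSpace HM] (I : ModelWithCorners ℝ EM HM)
  {M : Type*} [TopologicalSpace M] [ChartedSpace HM M]
  (F : Type*) [NormedAddCommGroup F] [NormedSpace ℝ F]
  (V : M → Type*) [TopologicalSpace (TotalSpace F V)]
  [∀ m, AddCommGroup (V m)] [∀ m, Module ℝ (V m)] [∀ m, TopologicalSpace (V m)]
  [FiberBundle F V]

variable {V} in
/-- The section `σ`, as a map from the base to the total space. -/
def sectionMap (σ : ∀ m, V m) : M → TotalSpace F V := fun x => ⟨x, σ x⟩

variable {V} in
/-- `σ` and `η` have the same 1-jet at `m`: `T_m σ = T_m η` as maps `T_m M → T E`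
(in particular `σ m = η m`, the base point of `T_m σ v` being `σ m`). -/
def SameJet (m : M) (σ η : ∀ m, V m) : Prop :=
  ∀ v : TangentSpace I m,
    tangentMap I (I.prod 𝓘(ℝ, F)) (sectionMap F σ) ⟨m, v⟩ =
      tangentMap I (I.prod 𝓘(ℝ, F)) (sectionMap F η) ⟨m, v⟩

variable {V} in
/-- The representation of a section in the preferred bundle trivialization at `x₀`. -/
def localRep (x₀ : M) (σ : ∀ m, V m) : M → F :=
  fun x => (trivializationAt F V x₀ ⟨x, σ x⟩).2

variable {V} in
/-- The local representation `u ↦ σ^A(u)` in the preferred chart and trivialization at `x₀`. -/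
def chartRep (x₀ : M) (σ : ∀ m, V m) : EM → F :=
  fun u => localRep F x₀ σ ((extChartAt I x₀).symm u)

variable [VectorBundle ℝ F V] [IsManifold I ∞ M] [ContMDiffVectorBundle ∞ F V I]

/-- Sections smooth on a neighbourhood of `m`.  (Away from that neighbourhood the values are
irrelevant: every local section extends by zero to such a function.) -/
def localSections (m : M) : Submodule ℝ (∀ x, V x) where
  carrier := {σ | ∀ᶠ x in 𝓝 m, ContMDiffAt I (I.prod 𝓘(ℝ, F)) ∞ (sectionMap F σ) x}
  add_mem' := by
    intro σ η hσ hη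
    filter_upwards [hσ, hη] with x h1 h2
    exact ContMDiffAt.add_section h1 h2
  zero_mem' := Eventually.of_forall fun x => (contMDiff_zeroSection ℝ V) x
  smul_mem' := by
    intro c σ hσ
    filter_upwards [hσ] with x h1
    exact ContMDiffAt.const_smul_section h1

variable {I F V}

lemma mdifferentiableAt_localSection {m : M} (σ : localSections I F V m) :
    MDifferentiableAt I (I.prod 𝓘(ℝ, F)) (sectionMap F (σ : ∀ x, V x)) m :=
  (σ.2.self_of_nhds).mdifferentiableAt (by simp)

lemma mdifferentiableAt_localRep {x₀ m : M} (hm : m ∈ (trivializationAt F V x₀).baseSet)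
    (σ : localSections I F V m) :
    MDifferentiableAt I 𝓘(ℝ, F) (localRep F x₀ (σ : ∀ x, V x)) m :=
  (((trivializationAt F V x₀).contMDiffAt_section_iff hm).1
    σ.2.self_of_nhds).mdifferentiableAt (by simp)

/-- Two sections have the same 1-jet iff their values and the derivatives of their local
representations agree. -/
lemma sameJet_iff {x₀ m : M} (hm : m ∈ (trivializationAt F V x₀).baseSet)
    (σ η : localSections I F V m) :
    SameJet I F m (σ : ∀ x, V x) (η : ∀ x, V x) ↔ localRep F x₀ σ.1 m = localRep F x₀ η.1 m ∧
      ∀ v : TangentSpace I m,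
        (mfderiv I 𝓘(ℝ, F) (localRep F x₀ σ.1) m v : F) = mfderiv I 𝓘(ℝ, F) (localRep F x₀ η.1) m v := by
  set e := trivializationAt F V x₀ with he
  constructor
  · intro h
    have hE : ∀ p : TotalSpace F V, p ∈ e.source →
        MDifferentiableAt (I.prod 𝓘(ℝ, F)) 𝓘(ℝ, F) (fun q => (e q).2) p := by
      intro p hp
      have h1 : ContMDiffAt (I.prod 𝓘(ℝ, F)) (I.prod 𝓘(ℝ, F)) ∞ e p :=
        (e.contMDiffOn (IB := I) (n := ∞)).contMDiffAt (e.open_source.mem_nhds hp)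
      exact (h1.snd).mdifferentiableAt (by simp)
    have key : ∀ (τ : localSections I F V m) (v : TangentSpace I m),
        tangentMap I 𝓘(ℝ, F) (localRep F x₀ τ.1) ⟨m, v⟩ =
        tangentMap (I.prod 𝓘(ℝ, F)) 𝓘(ℝ, F) (fun q => (e q).2)
          (tangentMap I (I.prod 𝓘(ℝ, F)) (sectionMap F τ.1) ⟨m, v⟩) := by
      intro τ v
      exact tangentMap_comp_at (I' := I.prod 𝓘(ℝ, F)) ⟨m, v⟩
        (hE _ (e.mem_source.2 hm)) (mdifferentiableAt_localSection τ)
    have h2 : ∀ v : TangentSpace I m, tangentMap I 𝓘(ℝ, F) (localRep F x₀ σ.1) ⟨m, v⟩ =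
        tangentMap I 𝓘(ℝ, F) (localRep F x₀ η.1) ⟨m, v⟩ := by
      intro v; rw [key, key, h v]
    refine ⟨congrArg TotalSpace.proj (h2 0), fun v => ?_⟩
    exact congrArg (fun p : TangentBundle 𝓘(ℝ, F) F => (p.2 : F)) (h2 v)
  · rintro ⟨h0, h1⟩ v
    have key : ∀ (τ : localSections I F V m),
        tangentMap I (I.prod 𝓘(ℝ, F)) (sectionMap F τ.1) ⟨m, v⟩ =
        tangentMap (I.prod 𝓘(ℝ, F)) (I.prod 𝓘(ℝ, F)) e.toOpenPartialHomeomorph.symm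
          ⟨(m, localRep F x₀ τ.1 m), (v, mfderiv I 𝓘(ℝ, F) (localRep F x₀ τ.1) m v)⟩ := by
      intro τ
      have hd := mdifferentiableAt_localRep hm τ
      have hdp : MDifferentiableAt I (I.prod 𝓘(ℝ, F)) (fun x => (x, localRep F x₀ τ.1 x)) m :=
        mdifferentiableAt_id.prodMk hd
      have hes : MDifferentiableAt (I.prod 𝓘(ℝ, F)) (I.prod 𝓘(ℝ, F))
          e.toOpenPartialHomeomorph.symm (m, localRep F x₀ τ.1 m) :=
        ((e.contMDiffOn_symm (IB := I) (n := ∞)).contMDiffAt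
          (e.open_target.mem_nhds (e.mem_target.2 hm))).mdifferentiableAt (by simp)
      have hev : sectionMap F τ.1 =ᶠ[𝓝 m]
          e.toOpenPartialHomeomorph.symm ∘ (fun x => (x, localRep F x₀ τ.1 x)) := by
        filter_upwards [e.open_baseSet.mem_nhds hm] with x hx
        have hx' : (⟨x, τ.1 x⟩ : TotalSpace F V) ∈ e.source := e.mem_source.2 hx
        have h3 : (x, localRep F x₀ τ.1 x) = e ⟨x, τ.1 x⟩ :=
          (e.mk_proj_snd hx')
        show _ = e.toOpenPartialHomeomorph.symm (x, localRep F x₀ τ.1 x)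
        rw [h3]
        exact (e.toOpenPartialHomeomorph.left_inv hx').symm
      have hm2 : (mfderiv I (I.prod 𝓘(ℝ, F)) (fun x => (x, localRep F x₀ τ.1 x)) m v : EM × F) =
          ((v : EM), (mfderiv I 𝓘(ℝ, F) (localRep F x₀ τ.1) m v : F)) :=
        DFunLike.congr_fun ((hasMFDerivAt_id m).prodMk hd.hasMFDerivAt).mfderiv v
      calc tangentMap I (I.prod 𝓘(ℝ, F)) (sectionMap F τ.1) ⟨m, v⟩
          = tangentMap I (I.prod 𝓘(ℝ, F))
            (e.toOpenPartialHomeomorph.symm ∘ (fun x => (x, localRep F x₀ τ.1 x))) ⟨m, v⟩ :=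
            tangentMap_congr hev v
        _ = tangentMap (I.prod 𝓘(ℝ, F)) (I.prod 𝓘(ℝ, F)) e.toOpenPartialHomeomorph.symm
            (tangentMap I (I.prod 𝓘(ℝ, F)) (fun x => (x, localRep F x₀ τ.1 x)) ⟨m, v⟩) :=
            tangentMap_comp_at (I' := I.prod 𝓘(ℝ, F)) ⟨m, v⟩ hes hdp
        _ = _ := congrArg (fun w : EM × F => tangentMap (I.prod 𝓘(ℝ, F)) (I.prod 𝓘(ℝ, F))
            e.toOpenPartialHomeomorph.symm ⟨(m, localRep F x₀ τ.1 m), w⟩) hm2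
    exact (key σ).trans ((congrArg₂ (fun y z : F => tangentMap (I.prod 𝓘(ℝ, F)) (I.prod 𝓘(ℝ, F))
      e.toOpenPartialHomeomorph.symm ⟨(m, y), ((v : EM), z)⟩) h0 (h1 v)).trans (key η).symm)

lemma localRep_add {x₀ m : M} (hm : m ∈ (trivializationAt F V x₀).baseSet) (σ η : ∀ x, V x) :
    localRep F x₀ (σ + η) m = localRep F x₀ σ m + localRep F x₀ η m :=
  ((trivializationAt F V x₀).linear ℝ hm).map_add _ _

lemma localRep_smul {x₀ m : M} (hm : m ∈ (trivializationAt F V x₀).baseSet) (c : ℝ)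
    (σ : ∀ x, V x) :
    localRep F x₀ (c • σ) m = c • localRep F x₀ σ m :=
  ((trivializationAt F V x₀).linear ℝ hm).map_smul _ _

/-- The derivative at `m` of the local representation of `σ`. -/
def localDeriv (I : ModelWithCorners ℝ EM HM) (x₀ m : M) (σ : ∀ x, V x) (v : TangentSpace I m) : F :=
  mfderiv I 𝓘(ℝ, F) (localRep F x₀ σ) m v

lemma localDeriv_add {x₀ m : M} (hm : m ∈ (trivializationAt F V x₀).baseSet)
    (σ η : localSections I F V m) (v : TangentSpace I m) :
    localDeriv (F := F) I x₀ m (σ + η : localSections I F V m).1 v =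
      localDeriv (F := F) I x₀ m σ.1 v + localDeriv (F := F) I x₀ m η.1 v := by
  have hev : localRep F x₀ (σ + η : localSections I F V m).1 =ᶠ[𝓝 m]
      localRep F x₀ σ.1 + localRep F x₀ η.1 := by
    filter_upwards [(trivializationAt F V x₀).open_baseSet.mem_nhds hm] with x hx
    exact localRep_add hx _ _
  exact DFunLike.congr_fun (((mdifferentiableAt_localRep hm σ).hasMFDerivAt.add
    (mdifferentiableAt_localRep hm η).hasMFDerivAt).congr_of_eventuallyEq hev).mfderiv v

lemma localDeriv_smul {x₀ m : M} (hm : m ∈ (trivializationAt F V x₀).baseSet)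
    (c : ℝ) (σ : localSections I F V m) (v : TangentSpace I m) :
    localDeriv (F := F) I x₀ m (c • σ : localSections I F V m).1 v =
      c • localDeriv (F := F) I x₀ m σ.1 v := by
  have hev : localRep F x₀ (c • σ : localSections I F V m).1 =ᶠ[𝓝 m]
      c • localRep F x₀ σ.1 := by
    filter_upwards [(trivializationAt F V x₀).open_baseSet.mem_nhds hm] with x hx
    exact localRep_smul hx _ _
  exact DFunLike.congr_fun (((mdifferentiableAt_localRep hm σ).hasMFDerivAt.const_smul c
    ).congr_of_eventuallyEq hev).mfderiv v

/-- The value and the derivative of the local representation of a section, as a linear map. -/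
def jetData {x₀ m : M} (hm : m ∈ (trivializationAt F V x₀).baseSet) :
    localSections I F V m →ₗ[ℝ] F × (TangentSpace I m → F) where
  toFun σ := (localRep F x₀ σ.1 m, localDeriv I x₀ m σ.1)
  map_add' σ η := Prod.ext (localRep_add hm _ _) (funext fun v => localDeriv_add hm σ η v)
  map_smul' c σ := Prod.ext (localRep_smul hm _ _) (funext fun v => localDeriv_smul hm c σ v)

lemma sameJet_iff_jetData {x₀ m : M} (hm : m ∈ (trivializationAt F V x₀).baseSet)
    (σ η : localSections I F V m) :
    SameJet I F m (σ : ∀ x, V x) (η : ∀ x, V x) ↔ jetData hm σ = jetData hm η := by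
  rw [sameJet_iff hm, Prod.ext_iff, funext_iff]
  rfl

variable (I F V)

/-- The sections whose 1-jet at `m` is the jet of the zero section. -/
def jetKer (m : M) : Submodule ℝ (localSections I F V m) where
  carrier := {σ | SameJet I F m (σ : ∀ x, V x) 0}
  zero_mem' := fun _ => rfl
  add_mem' := by
    intro σ η hσ hη
    have hm := FiberBundle.mem_baseSet_trivializationAt' (F := F) (E := V) m
    have h1 := (sameJet_iff_jetData hm σ 0).1 hσ
    have h2 := (sameJet_iff_jetData hm η 0).1 hη
    exact (sameJet_iff_jetData hm (σ + η) 0).2 (by rw [map_add, h1, h2, map_zero, add_zero])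
  smul_mem' := by
    intro c σ hσ
    have hm := FiberBundle.mem_baseSet_trivializationAt' (F := F) (E := V) m
    have h1 := (sameJet_iff_jetData hm σ 0).1 hσ
    exact (sameJet_iff_jetData hm (c • σ) 0).2 (by rw [map_smul, h1, map_zero, smul_zero])

/-- The fibre over `m` of the first jet bundle `π₁ : J¹π → M`: smooth local sections modulo
equality of 1-jets at `m`, with `j σ + j η = j (σ + η)` and `c • j σ = j (c • σ)`. -/
def Jet (m : M) : Type _ := localSections I F V m ⧸ jetKer I F V m

instance (m : M) : AddCommGroup (Jet I F V m) :=
  inferInstanceAs (AddCommGroup (localSections I F V m ⧸ jetKer I F V m))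

instance (m : M) : Module ℝ (Jet I F V m) :=
  inferInstanceAs (Module ℝ (localSections I F V m ⧸ jetKer I F V m))

/-- The total space of the first jet bundle `J¹π`. -/
abbrev JetSpace : Type _ := Σ m : M, Jet I F V m

variable {I F V}

/-- The 1-jet `j¹_m σ`. -/
def jet {m : M} : localSections I F V m →ₗ[ℝ] Jet I F V m := (jetKer I F V m).mkQ

lemma jet_eq_iff {m : M} (σ η : localSections I F V m) :
    jet σ = jet η ↔ SameJet I F m (σ : ∀ x, V x) (η : ∀ x, V x) := by
  have hm := FiberBundle.mem_baseSet_trivializationAt' (F := F) (E := V) m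
  rw [sameJet_iff_jetData hm, ← sub_eq_zero (a := jetData hm σ), ← map_sub]
  refine (Submodule.Quotient.eq (jetKer I F V m)).trans ?_
  refine (sameJet_iff_jetData hm (σ - η) 0).trans ?_
  rw [map_zero]

/-- The target projection `π₁₀ : J¹π → E`, `j¹_m σ ↦ σ m`, restricted to the fibre over `m`. -/
def Jet.target {m : M} : Jet I F V m →ₗ[ℝ] V m :=
  (jetKer I F V m).liftQ ((LinearMap.proj m).comp (localSections I F V m).subtype) (by
    intro σ hσ
    have h : (⟨m, σ.1 m⟩ : TotalSpace F V) = ⟨m, 0⟩ := congrArg TotalSpace.proj (hσ 0)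
    simpa using h)

/-- A jet as a linear map on tangent vectors: `(j¹_m σ)(v) = T_m σ (v)`, a vector tangent to the
total space at the target of the jet. -/
def Jet.push {m : M} (j : Jet I F V m) (v : TangentSpace I m) :
    TangentBundle (I.prod 𝓘(ℝ, F)) (TotalSpace F V) :=
  Quotient.liftOn' j
    (fun σ => tangentMap I (I.prod 𝓘(ℝ, F)) (sectionMap F (σ : ∀ x, V x)) ⟨m, v⟩)
    (fun σ η h => (jet_eq_iff σ η).1 (Quotient.sound' h) v)

/-- The coordinates `(y^A, y^A_i)` of a jet at `m` in the preferred chart and trivialization at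
`x₀`: the value and the derivative of the local representation of a section with that jet.
Meaningful for `m` in the domains of both; there it does not depend on the representative. -/
def Jet.coord (x₀ : M) {m : M} (j : Jet I F V m) : F × (EM →L[ℝ] F) :=
  let σ : localSections I F V m := Quotient.out (s := Submodule.quotientRel _) j
  (localRep F x₀ σ.1 m, fderiv ℝ (chartRep I F x₀ σ.1) (extChartAt I x₀ m))

/-- The jet coordinates can be computed with any representative. -/
lemma Jet.coord_jet [I.Boundaryless] {x₀ m : M} (hm : m ∈ (chartAt HM x₀).source)
    (hm' : m ∈ (trivializationAt F V x₀).baseSet) (σ : localSections I F V m) :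
    (jet σ).coord x₀ = (localRep F x₀ σ.1 m, fderiv ℝ (chartRep I F x₀ σ.1) (extChartAt I x₀ m)) := by
  have hout : jet (Quotient.out (s := Submodule.quotientRel _) (jet σ)) = jet σ :=
    Quotient.out_eq (s := Submodule.quotientRel _) (jet σ)
  have h := (sameJet_iff hm' _ _).1 ((jet_eq_iff _ _).1 hout)
  have hms : m ∈ (extChartAt I x₀).source := by rwa [extChartAt_source]
  have key : ∀ τ : localSections I F V m,
      HasMFDerivAt 𝓘(ℝ, EM) 𝓘(ℝ, F) (chartRep I F x₀ τ.1) (extChartAt I x₀ m)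
        ((mfderiv I 𝓘(ℝ, F) (localRep F x₀ τ.1) m).comp
          (mfderiv 𝓘(ℝ, EM) I (extChartAt I x₀).symm (extChartAt I x₀ m))) := by
    intro τ
    have hx : MDifferentiableAt 𝓘(ℝ, EM) I (extChartAt I x₀).symm (extChartAt I x₀ m) :=
      ((contMDiffOn_extChartAt_symm (n := ∞) x₀).contMDiffAt
        ((isOpen_extChartAt_target x₀).mem_nhds
          ((extChartAt I x₀).map_source hms))).mdifferentiableAt (by simp)
    have hl := (mdifferentiableAt_localRep hm' τ).hasMFDerivAt
    have hinv := (extChartAt I x₀).left_inv hms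
    refine HasMFDerivAt.comp (I' := I) _ ?_ hx.hasMFDerivAt
    rw [hinv]
    exact hl
  have key' : ∀ (τ : localSections I F V m) (u : EM),
      fderiv ℝ (chartRep I F x₀ τ.1) (extChartAt I x₀ m) u = localDeriv I x₀ m τ.1
        (mfderiv 𝓘(ℝ, EM) I (extChartAt I x₀).symm (extChartAt I x₀ m) u) := fun τ u =>
    (DFunLike.congr_fun mfderiv_eq_fderiv.symm u).trans (DFunLike.congr_fun (key τ).mfderiv u)
  refine Prod.ext h.1 (ContinuousLinearMap.ext fun u => ?_)
  exact (key' _ u).trans ((h.2 _).trans (key' σ u).symm)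

/-- The vector topology of the fibre `J¹_m π`, transported by the coordinates `(y^A, y^A_i)`. -/
instance (m : M) : TopologicalSpace (Jet I F V m) :=
  TopologicalSpace.induced (fun j => j.coord m) inferInstance

variable (I F V) in
/-- A (nonlinear) connection on `π : E → M`: a smooth section `h : E → J¹π` of the target
projection `π₁₀`.  Smoothness is smoothness of the coordinate expression
`(x, y) ↦ (y^A, y^A_i)` of `h` in the adapted charts of `J¹π` around each point. -/
structure Connection where
  /-- the jet `h b ∈ J¹_m π`, for `b` in the fibre over `m` -/
  toFun : ∀ m, V m → Jet I F V m
  target_toFun : ∀ m b, (toFun m b).target = b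
  smooth : ∀ p : TotalSpace F V,
    ContMDiffAt (I.prod 𝓘(ℝ, F)) 𝓘(ℝ, F × (EM →L[ℝ] F)) ∞
      (fun q : TotalSpace F V => (toFun q.proj q.2).coord p.proj) p

namespace Connection

/-- The section `h : E → J¹π` as a map between total spaces. -/
def toMap (h : Connection I F V) : TotalSpace F V → JetSpace I F V :=
  fun p => ⟨p.proj, h.toFun p.proj p.2⟩

/-- The horizontal lift `ξ^H(b, v) = h(b)(v) ∈ T_b E` of `v ∈ T_m M`, `m = π b`. -/
def horLift (h : Connection I F V) {m : M} (b : V m) (v : TangentSpace I m) :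
    TangentBundle (I.prod 𝓘(ℝ, F)) (TotalSpace F V) :=
  (h.toFun m b).push v

/-- The connection is linear: `h` is a vector bundle morphism from `π : E → M` to
`π₁ : J¹π → M`. -/
def IsLinear (h : Connection I F V) : Prop :=
  ∀ m, IsLinearMap ℝ (h.toFun m)

end Connection

end Jets
/-! ## The pullback bundle, the canonical immersion and the fibre derivative -/

section Pullback

variable {EM : Type*} [NormedAddCommGroup EM] [NormedSpace ℝ EM]
  {HM : Type*} [TopologicalSpace HM] (I : ModelWithCorners ℝ EM HM)
  {M : Type*} [TopologicalSpace M] [ChartedSpace HM M]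
  (F : Type*) [NormedAddCommGroup F] [NormedSpace ℝ F]
  (V : M → Type*) [TopologicalSpace (TotalSpace F V)]
  [∀ m, AddCommGroup (V m)] [∀ m, Module ℝ (V m)] [∀ m, TopologicalSpace (V m)]
  [FiberBundle F V] [VectorBundle ℝ F V] [IsManifold I ∞ M] [ContMDiffVectorBundle ∞ F V I]

/-- The projection `π : E → M`, as a smooth map. -/
def bundleProj : C^∞⟮I.prod 𝓘(ℝ, F), TotalSpace F V; I, M⟯ :=
  ⟨TotalSpace.proj, contMDiff_proj V⟩

/-- The fibres of the pullback bundle `π^*π : π^*E → E`: over `a ∈ E` the fibre is `E_{π a}`. -/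
abbrev PullbackFibre : TotalSpace F V → Type _ :=
  (bundleProj I F V : TotalSpace F V → M) *ᵖ V

instance (a : TotalSpace F V) : AddCommGroup (PullbackFibre I F V a) :=
  inferInstanceAs (AddCommGroup (V a.proj))

/-- The manifold `π^*E = {(a, b) | π a = π b}`. -/
abbrev PullbackSpace : Type _ := TotalSpace F (PullbackFibre I F V)

/-- The second projection `pr₂ : π^*E → E`, `(a, b) ↦ b`.  (The first one, `pr₁ (a, b) = a`, is the
bundle projection `TotalSpace.proj`.) -/
def pr₂ : PullbackSpace I F V → TotalSpace F V :=
  Pullback.lift (bundleProj I F V)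

variable {I F V}

/-- `ι σ (a) = (a, σ (π a))`, the section of `π^*π` determined by a section `σ` of `π`. -/
def pullbackSection (σ : ∀ m, V m) : ∀ a, PullbackFibre I F V a :=
  fun a => σ a.proj

lemma localRep_pullbackSection (a : TotalSpace F V) (σ : ∀ m, V m) :
    localRep F a (pullbackSection (I := I) (F := F) σ) = localRep F a.proj σ ∘ TotalSpace.proj :=
  rfl

variable (I F V) in
/-- `σ ↦ ι σ` on local sections. -/
def pullbackLocalSection (a : TotalSpace F V) :
    localSections I F V a.proj →ₗ[ℝ]
      localSections (I.prod 𝓘(ℝ, F)) F (PullbackFibre I F V) a where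
  toFun σ := ⟨pullbackSection σ.1, by
    have h1 : Tendsto (TotalSpace.proj : TotalSpace F V → M) (𝓝 a) (𝓝 a.proj) :=
      (FiberBundle.continuous_proj F V).continuousAt
    filter_upwards [h1.eventually σ.2, h1 ((trivializationAt F V a.proj).open_baseSet.mem_nhds
      (FiberBundle.mem_baseSet_trivializationAt' a.proj))] with q hq hq'
    refine ((trivializationAt F (PullbackFibre I F V) a).contMDiffAt_section_iff
      (IB := I.prod 𝓘(ℝ, F)) (x₀ := q) hq').2 ?_
    have h2 : ContMDiffAt (I.prod 𝓘(ℝ, F)) I ∞ (TotalSpace.proj : TotalSpace F V → M) q :=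
      contMDiffAt_proj V
    have h3 : ContMDiffAt I 𝓘(ℝ, F) ∞ (localRep F a.proj σ.1) q.proj :=
      ((trivializationAt F V a.proj).contMDiffAt_section_iff (IB := I) hq').1 hq
    exact h3.comp q h2⟩
  map_add' _ _ := rfl
  map_smul' _ _ := rfl

lemma sameJet_pullbackSection (a : TotalSpace F V) (σ : localSections I F V a.proj)
    (h : SameJet I F a.proj σ.1 0) :
    SameJet (I.prod 𝓘(ℝ, F)) F a (pullbackLocalSection I F V a σ).1 0 := by
  have hm := FiberBundle.mem_baseSet_trivializationAt' (F := F) (E := V) a.proj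
  have hma := FiberBundle.mem_baseSet_trivializationAt' (F := F) (E := PullbackFibre I F V) a
  have h' := (sameJet_iff hm σ 0).1 h
  refine (sameJet_iff hma (pullbackLocalSection I F V a σ) 0).2 ⟨h'.1, fun w => ?_⟩
  have key : ∀ τ : localSections I F V a.proj,
      (mfderiv (I.prod 𝓘(ℝ, F)) 𝓘(ℝ, F) (localRep F a.proj τ.1 ∘ TotalSpace.proj) a w : F) =
        mfderiv I 𝓘(ℝ, F) (localRep F a.proj τ.1) a.proj
          (mfderiv (I.prod 𝓘(ℝ, F)) I (TotalSpace.proj : TotalSpace F V → M) a w) := fun τ =>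
    mfderiv_comp_apply a (mdifferentiableAt_localRep hm τ) (mdifferentiableAt_proj V) w
  exact (key σ).trans ((h'.2 _).trans (key 0).symm)

variable (I F V) in
/-- The canonical immersion `Υ : π^*(J¹π) → J¹(π^*π)`, `Υ(a, j¹_m σ) = j¹_a (ι σ)`, over `a ∈ E`. -/
def canonicalImmersion (a : TotalSpace F V) :
    Jet I F V a.proj →ₗ[ℝ] Jet (I.prod 𝓘(ℝ, F)) F (PullbackFibre I F V) a :=
  (jetKer I F V a.proj).mapQ (jetKer (I.prod 𝓘(ℝ, F)) F (PullbackFibre I F V) a)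
    (pullbackLocalSection I F V a) (fun σ hσ => sameJet_pullbackSection a σ hσ)

/-- `Ψ : π₁^*(J¹π) → J¹(π^*π)`, `Ψ(j¹_m σ, j¹_m η) = Υ(σ m, j¹_m η)`.  A point of `π₁^*(J¹π)` is a
pair of jets of sections of `π` with the same source. -/
def jetMap (c : Σ j : JetSpace I F V, Jet I F V j.1) :
    JetSpace (I.prod 𝓘(ℝ, F)) F (PullbackFibre I F V) :=
  ⟨⟨c.1.1, c.1.2.target⟩, canonicalImmersion I F V ⟨c.1.1, c.1.2.target⟩ c.2⟩

/-- The fibre derivative `ℱφ : π^*E → τ^*W` of a (not necessarily linear) fibred map `φ : E → W`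
over the identity of `M`, into a vector bundle `τ : W → M`: `ℱφ(a, b) = (φ a, ℱ_a φ b)`, where
`ℱ_a φ b = lim_{s → 0} s⁻¹ (φ (a + s b) - φ a)` in the fibre of `W`.
A point of `τ^*W` is a pair of points of `W` in the same fibre. -/
def fibreDeriv {W : M → Type*} [∀ m, AddCommGroup (W m)] [∀ m, Module ℝ (W m)]
    [∀ m, TopologicalSpace (W m)] (φ : ∀ m, V m → W m) (p : PullbackSpace I F V) :
    Σ c : (Σ m, W m), W c.1 :=
  let m : M := p.proj.proj
  let a : V m := p.proj.2
  let b : V m := p.2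
  ⟨⟨m, φ m a⟩, limUnder (𝓝[≠] (0 : ℝ)) fun s => s⁻¹ • (φ m (a + s • b) - φ m a)⟩

/-! ## The linearization of a connection -/

/-- The velocity at `s = 0` of a curve in the manifold `TE`, an element of `T(TE)`. -/
def velocity (γ : ℝ → TangentBundle (I.prod 𝓘(ℝ, F)) (TotalSpace F V)) :
    TangentBundle (I.prod 𝓘(ℝ, F)).tangent (TangentBundle (I.prod 𝓘(ℝ, F)) (TotalSpace F V)) :=
  tangentMap 𝓘(ℝ, ℝ) (I.prod 𝓘(ℝ, F)).tangent γ ⟨0, 1⟩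

/-- The fibrewise operation `(a, b) ↦ a + s b`, `π^*E → E`. -/
def addSMul (s : ℝ) (p : PullbackSpace I F V) : TotalSpace F V :=
  let m : M := p.proj.proj
  let a : V m := p.proj.2
  let b : V m := p.2
  ⟨m, a + s • b⟩

/-- The vertical lift `ξ^v_{Tπ} : T(π^*E) ≃ (Tπ)^*(TE) → T(TE)` of the vector bundle
`Tπ : TE → TM`, `(v, w) ↦ d/ds (v +_τ s ·_τ w)` at `s = 0`.  The tangent vector `u` of `π^*E` stands
for the pair `(v, w) = (T pr₁ u, T pr₂ u)`; as the operations of `Tπ` are the differentials of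
those of `π`, the vector `v +_τ s ·_τ w` is the image of `u` under the differential of
`(a, b) ↦ a + s b`. -/
def vertLift (u : TangentBundle ((I.prod 𝓘(ℝ, F)).prod 𝓘(ℝ, F)) (PullbackSpace I F V)) :
    TangentBundle (I.prod 𝓘(ℝ, F)).tangent (TangentBundle (I.prod 𝓘(ℝ, F)) (TotalSpace F V)) :=
  velocity fun s => tangentMap ((I.prod 𝓘(ℝ, F)).prod 𝓘(ℝ, F)) (I.prod 𝓘(ℝ, F)) (addSMul s) u

open Classical in
/-- The vertical projection `ν_{Tπ} : Ver(Tπ) → TE`, `ν_{Tπ}(ξ^v_{Tπ}(v, w)) = w`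
(extended by zero vectors outside `Ver(Tπ)`, the range of the injective map `ξ^v_{Tπ}`). -/
def vertProj (X : TangentBundle (I.prod 𝓘(ℝ, F)).tangent
      (TangentBundle (I.prod 𝓘(ℝ, F)) (TotalSpace F V))) :
    TangentBundle (I.prod 𝓘(ℝ, F)) (TotalSpace F V) :=
  if hX : ∃ u : TangentBundle ((I.prod 𝓘(ℝ, F)).prod 𝓘(ℝ, F)) (PullbackSpace I F V),
      vertLift u = X then
    tangentMap ((I.prod 𝓘(ℝ, F)).prod 𝓘(ℝ, F)) (I.prod 𝓘(ℝ, F)) (pr₂ I F V) hX.choose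
  else ⟨X.proj.proj, 0⟩

namespace Connection

/-- `B(a, b) w = ν_{Tπ} (d/ds ξ^H(a + s b, Tπ w) at s = 0)`, for `(a, b) ∈ π^*E`, `w ∈ T_a E`. -/
def linB (h : Connection I F V) (p : PullbackSpace I F V)
    (w : TangentSpace (I.prod 𝓘(ℝ, F)) p.proj) :
    TangentBundle (I.prod 𝓘(ℝ, F)) (TotalSpace F V) :=
  let m : M := p.proj.proj
  let a : V m := p.proj.2
  let b : V m := p.2
  let w' : TangentSpace I m := mfderiv (I.prod 𝓘(ℝ, F)) I TotalSpace.proj p.proj w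
  vertProj (velocity fun s => h.horLift (a + s • b) w')

/-- The connection `k` on `π^*π` is the linearization of the connection `h` on `π`: its horizontal
lift is `((a, b), w) ↦ (w, B(a, b) w)`, where `T(π^*E)` is identified with `(Tπ)^*(TE)` by means of
`(T pr₁, T pr₂)`. -/
def IsLinearization (h : Connection I F V)
    (k : Connection (I.prod 𝓘(ℝ, F)) F (PullbackFibre I F V)) : Prop :=
  ∀ (p : PullbackSpace I F V) (w : TangentSpace (I.prod 𝓘(ℝ, F)) p.proj),
    tangentMap ((I.prod 𝓘(ℝ, F)).prod 𝓘(ℝ, F)) (I.prod 𝓘(ℝ, F)) TotalSpace.proj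
        (k.horLift p.2 w) = ⟨p.proj, w⟩ ∧
      tangentMap ((I.prod 𝓘(ℝ, F)).prod 𝓘(ℝ, F)) (I.prod 𝓘(ℝ, F)) (pr₂ I F V)
        (k.horLift p.2 w) = h.linB p w

end Connection

end Pullback

end NonlinearConnection

namespace NonlinearConnection

/-! ### Coordinates on the fibres of the jet bundle. -/

section JetCoordinates

variable {EM : Type*} [NormedAddCommGroup EM] [NormedSpace ℝ EM]
  {HM : Type*} [TopologicalSpace HM] {I : ModelWithCorners ℝ EM HM}
  {M : Type*} [TopologicalSpace M] [ChartedSpace HM M]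
  {F : Type*} [NormedAddCommGroup F] [NormedSpace ℝ F]
  {V : M → Type*} [TopologicalSpace (TotalSpace F V)]
  [∀ m, AddCommGroup (V m)] [∀ m, Module ℝ (V m)] [∀ m, TopologicalSpace (V m)]
  [FiberBundle F V] [VectorBundle ℝ F V] [IsManifold I ∞ M] [ContMDiffVectorBundle ∞ F V I]

/-! In adapted coordinates `h` is `(x, y) ↦ (y, Γ(x, y))` with `Γ(x, y)` a continuous linear map
from `EM` to `F`. Its fibre derivative at `(x, y)` in direction `z` is `(z, ∂₂Γ(x, y) z)`: a jet
with target `z`, linear in `z` and smooth in all variables. The immersion `Υ` only precomposes the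
derivative part with the projection `EM × F → EM`. Hence `Ψ ∘ ℱh` is a smooth linear connection.
Since the fibre derivative is defined by `limUnder`, the limit must first be shown to exist
(`tendsto_fibreDerivJet`); afterwards `hasDerivAt_coord_toFun` describes it in every adapted chart.

For the linearization, let `k` be the fibre derivative at `a` in direction `b`. The curves `h(a +
sb)` and `h(a) + sk` of jets agree to first order at `s = 0`, so applying them to a tangent vector
gives curves in `TE` with the same velocity (`velocity_push`). If sections `σ`, `η` represent `h(a)`
and `k`, the second curve is `T(σ + sη)(v)`, whose velocity is the vertical lift of the pair `(Tσ v,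
Tη v)`; thus `ν` returns `Tη v = k(v)` (`vertProj_velocity_push_add_smul`). So `B(a, b)w = k(Tπ w)`.
On the other side the lift of `h̄` is `T(ιη)(w)`, and `pr₁ ∘ ιη = id`, `pr₂ ∘ ιη = η ∘ π` give the
components `w` and `Tη(Tπ w)`. -/

lemma jet_surjective {m : M} (j : Jet I F V m) : ∃ σ : localSections I F V m, jet σ = j :=
  Submodule.mkQ_surjective _ j

lemma Jet.push_jet {m : M} (σ : localSections I F V m) (v : TangentSpace I m) :
    (jet σ).push v = tangentMap I (I.prod 𝓘(ℝ, F)) (sectionMap F σ.1) ⟨m, v⟩ := rfl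

variable [I.Boundaryless]

lemma mdifferentiableAt_extChartAt_symm' {x₀ m : M} (hm : m ∈ (chartAt HM x₀).source) :
    MDifferentiableAt 𝓘(ℝ, EM) I (extChartAt I x₀).symm (extChartAt I x₀ m) :=
  ((contMDiffOn_extChartAt_symm (n := ∞) x₀).contMDiffAt
    ((isOpen_extChartAt_target x₀).mem_nhds
      ((extChartAt I x₀).map_source (by rwa [extChartAt_source])))).mdifferentiableAt (by simp)

lemma hasMFDerivAt_chartRep {x₀ m : M} (hm : m ∈ (chartAt HM x₀).source)
    (hm' : m ∈ (trivializationAt F V x₀).baseSet) (σ : localSections I F V m) :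
    HasMFDerivAt 𝓘(ℝ, EM) 𝓘(ℝ, F) (chartRep I F x₀ σ.1) (extChartAt I x₀ m)
      ((mfderiv I 𝓘(ℝ, F) (localRep F x₀ σ.1) m).comp
        (mfderiv 𝓘(ℝ, EM) I (extChartAt I x₀).symm (extChartAt I x₀ m))) := by
  have hl := (mdifferentiableAt_localRep hm' σ).hasMFDerivAt
  have hinv := (extChartAt I x₀).left_inv (by rwa [extChartAt_source] : m ∈ (extChartAt I x₀).source)
  refine HasMFDerivAt.comp (I' := I) _ ?_ (mdifferentiableAt_extChartAt_symm' hm).hasMFDerivAt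
  rw [hinv]
  exact hl

lemma differentiableAt_chartRep {x₀ m : M} (hm : m ∈ (chartAt HM x₀).source)
    (hm' : m ∈ (trivializationAt F V x₀).baseSet) (σ : localSections I F V m) :
    DifferentiableAt ℝ (chartRep I F x₀ σ.1) (extChartAt I x₀ m) :=
  (hasMFDerivAt_chartRep hm hm' σ).mdifferentiableAt.differentiableAt

lemma fderiv_chartRep_apply {x₀ m : M} (hm : m ∈ (chartAt HM x₀).source)
    (hm' : m ∈ (trivializationAt F V x₀).baseSet) (σ : localSections I F V m) (u : EM) :
    fderiv ℝ (chartRep I F x₀ σ.1) (extChartAt I x₀ m) u = localDeriv I x₀ m σ.1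
        (mfderiv 𝓘(ℝ, EM) I (extChartAt I x₀).symm (extChartAt I x₀ m) u) :=
  (DFunLike.congr_fun mfderiv_eq_fderiv.symm u).trans
    (DFunLike.congr_fun (hasMFDerivAt_chartRep hm hm' σ).mfderiv u)

/-- The counterpart of `fderiv_chartRep_apply`: near `m` the local representation is the chart
representation composed with the chart. It makes the coordinates determine the jet and its action on
tangent vectors. -/
lemma localDeriv_eq_fderiv_chartRep {x₀ m : M} (hm : m ∈ (chartAt HM x₀).source)
    (hm' : m ∈ (trivializationAt F V x₀).baseSet) (σ : localSections I F V m)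
    (v : TangentSpace I m) :
    localDeriv I x₀ m σ.1 v = fderiv ℝ (chartRep I F x₀ σ.1) (extChartAt I x₀ m)
      (mfderiv I 𝓘(ℝ, EM) (extChartAt I x₀) m v) := by
  have hev : localRep F x₀ σ.1 =ᶠ[𝓝 m] chartRep I F x₀ σ.1 ∘ extChartAt I x₀ := by
    filter_upwards [(chartAt HM x₀).open_source.mem_nhds hm] with x hx
    show _ = localRep F x₀ σ.1 ((extChartAt I x₀).symm (extChartAt I x₀ x))
    rw [(extChartAt I x₀).left_inv (by rwa [extChartAt_source])]
  have hφ : MDifferentiableAt I 𝓘(ℝ, EM) (extChartAt I x₀) m :=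
    mdifferentiableAt_extChartAt hm
  have hc := (differentiableAt_chartRep hm hm' σ).hasFDerivAt.hasMFDerivAt
  exact DFunLike.congr_fun
    ((HasMFDerivAt.comp (I' := 𝓘(ℝ, EM)) m hc hφ.hasMFDerivAt).congr_of_eventuallyEq hev).mfderiv v

lemma Jet.coord_add {x₀ m : M} (hm : m ∈ (chartAt HM x₀).source)
    (hm' : m ∈ (trivializationAt F V x₀).baseSet) (j k : Jet I F V m) :
    (j + k).coord x₀ = j.coord x₀ + k.coord x₀ := by
  obtain ⟨σ, rfl⟩ := jet_surjective j
  obtain ⟨η, rfl⟩ := jet_surjective k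
  rw [← map_add, coord_jet hm hm', coord_jet hm hm', coord_jet hm hm']
  refine Prod.ext (localRep_add hm' _ _) (ContinuousLinearMap.ext fun u => ?_)
  exact (fderiv_chartRep_apply hm hm' (σ + η) u).trans <| (localDeriv_add hm' σ η _).trans <|
    congrArg₂ (· + ·) (fderiv_chartRep_apply hm hm' σ u).symm
      (fderiv_chartRep_apply hm hm' η u).symm

lemma Jet.coord_smul {x₀ m : M} (hm : m ∈ (chartAt HM x₀).source)
    (hm' : m ∈ (trivializationAt F V x₀).baseSet) (c : ℝ) (j : Jet I F V m) :
    (c • j).coord x₀ = c • j.coord x₀ := by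
  obtain ⟨σ, rfl⟩ := jet_surjective j
  rw [← map_smul, coord_jet hm hm', coord_jet hm hm']
  refine Prod.ext (localRep_smul hm' _ _) (ContinuousLinearMap.ext fun u => ?_)
  exact (fderiv_chartRep_apply hm hm' (c • σ) u).trans <| (localDeriv_smul hm' c σ _).trans <|
    congrArg (c • ·) (fderiv_chartRep_apply hm hm' σ u).symm

/-- The jet coordinates as a linear map. -/
def Jet.coordLinear {x₀ m : M} (hm : m ∈ (chartAt HM x₀).source)
    (hm' : m ∈ (trivializationAt F V x₀).baseSet) : Jet I F V m →ₗ[ℝ] F × (EM →L[ℝ] F) where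
  toFun j := j.coord x₀
  map_add' := coord_add hm hm'
  map_smul' := coord_smul hm hm'

lemma Jet.coord_injective {x₀ m : M} (hm : m ∈ (chartAt HM x₀).source)
    (hm' : m ∈ (trivializationAt F V x₀).baseSet) :
    Function.Injective fun j : Jet I F V m => j.coord x₀ := by
  intro j k hjk
  obtain ⟨σ, rfl⟩ := jet_surjective j
  obtain ⟨η, rfl⟩ := jet_surjective k
  simp only [coord_jet hm hm', Prod.mk.injEq] at hjk
  refine (jet_eq_iff σ η).2 ((sameJet_iff hm' σ η).2 ⟨hjk.1, fun v => ?_⟩)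
  refine (localDeriv_eq_fderiv_chartRep hm hm' σ v).trans ?_
  rw [hjk.2]
  exact (localDeriv_eq_fderiv_chartRep hm hm' η v).symm

lemma Jet.coord_fst {x₀ m : M} (hm : m ∈ (chartAt HM x₀).source)
    (hm' : m ∈ (trivializationAt F V x₀).baseSet) (j : Jet I F V m) :
    (j.coord x₀).1 = (trivializationAt F V x₀ ⟨m, j.target⟩).2 := by
  obtain ⟨σ, rfl⟩ := jet_surjective j
  rw [coord_jet hm hm']
  rfl

variable (I F V) in
/-- A local section with prescribed jet coordinates at the point `m`. -/
def affineSection (m : M) (c : F × (EM →L[ℝ] F)) : localSections I F V m :=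
  ⟨fun x => (trivializationAt F V m).symm x
    (c.1 + c.2 (extChartAt I m x - extChartAt I m m)), by
    filter_upwards [(trivializationAt F V m).open_baseSet.mem_nhds
      (FiberBundle.mem_baseSet_trivializationAt' (F := F) (E := V) m),
      (chartAt HM m).open_source.mem_nhds (mem_chart_source HM m)] with x hx hx'
    refine ((trivializationAt F V m).contMDiffAt_section_iff (IB := I) hx).2 ?_
    have h1 : ContMDiffAt I 𝓘(ℝ, F) ∞
        (fun x => c.1 + c.2 (extChartAt I m x - extChartAt I m m)) x := by
      have h2 : ContDiff ℝ ∞ fun u : EM => c.1 + c.2 (u - extChartAt I m m) := by fun_prop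
      exact h2.contMDiff.contMDiffAt.comp x (contMDiffAt_extChartAt' hx')
    refine h1.congr_of_eventuallyEq ?_
    filter_upwards [(trivializationAt F V m).open_baseSet.mem_nhds hx] with z hz
    exact congrArg Prod.snd ((trivializationAt F V m).apply_mk_symm hz _)⟩

/-- Every pair of coordinates is attained, so a limit computed in coordinates is the coordinate of
an actual jet. -/
lemma Jet.coord_affineSection (m : M) (c : F × (EM →L[ℝ] F)) :
    (jet (affineSection I F V m c)).coord m = c := by
  have hb := FiberBundle.mem_baseSet_trivializationAt' (F := F) (E := V) m
  have hs := mem_chart_source HM m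
  rw [coord_jet hs hb]
  have hrep : ∀ x ∈ (trivializationAt F V m).baseSet,
      localRep F m (affineSection I F V m c).1 x
        = c.1 + c.2 (extChartAt I m x - extChartAt I m m) := fun x hx =>
    congrArg Prod.snd ((trivializationAt F V m).apply_mk_symm hx _)
  refine Prod.ext ((hrep m hb).trans (by simp)) ?_
  have hev : chartRep I F m (affineSection I F V m c).1 =ᶠ[𝓝 (extChartAt I m m)]
      fun u => c.1 + c.2 (u - extChartAt I m m) := by
    have h1 : Tendsto (extChartAt I m).symm (𝓝 (extChartAt I m m)) (𝓝 m) := by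
      have := continuousAt_extChartAt_symm (I := I) m
      rwa [ContinuousAt, extChartAt_to_inv] at this
    filter_upwards [h1 ((trivializationAt F V m).open_baseSet.mem_nhds hb),
      extChartAt_target_mem_nhds (I := I) m] with u hu hu'
    refine (hrep _ hu).trans ?_
    rw [(extChartAt I m).right_inv hu']
  have hd : HasFDerivAt (fun u : EM => c.1 + c.2 (u - extChartAt I m m)) c.2
      (extChartAt I m m) :=
    (c.2.hasFDerivAt.comp (extChartAt I m m) ((hasFDerivAt_id (𝕜 := ℝ) (extChartAt I m m)).sub_const
      (extChartAt I m m))).const_add c.1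
  exact (hd.congr_of_eventuallyEq hev).fderiv

/-- On a fixed fibre, the change of jet coordinates. -/
lemma Jet.exists_coord_change {x₀ x₁ m : M} (hm : m ∈ (chartAt HM x₀).source)
    (hm' : m ∈ (trivializationAt F V x₀).baseSet) (hn : m ∈ (chartAt HM x₁).source)
    (hn' : m ∈ (trivializationAt F V x₁).baseSet) :
    ∃ (A : F →L[ℝ] F) (B : EM →L[ℝ] EM) (C : EM →L[ℝ] F →L[ℝ] F), ∀ j : Jet I F V m,
      j.coord x₁ = (A (j.coord x₀).1, A ∘L (j.coord x₀).2 ∘L B + C.flip (j.coord x₀).1) := by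
  set e₀ := trivializationAt F V x₀ with he₀
  set e₁ := trivializationAt F V x₁ with he₁
  set u₁ := extChartAt I x₁ m with hu₁
  have hinv : (extChartAt I x₁).symm u₁ = m :=
    (extChartAt I x₁).left_inv (by rwa [extChartAt_source])
  have hsymm : MDifferentiableAt 𝓘(ℝ, EM) I (extChartAt I x₁).symm u₁ :=
    mdifferentiableAt_extChartAt_symm' hn
  have hcc : DifferentiableAt ℝ
      (fun u => (e₀.coordChangeL ℝ e₁ ((extChartAt I x₁).symm u) : F →L[ℝ] F)) u₁ := by
    refine MDifferentiableAt.differentiableAt ?_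
    refine MDifferentiableAt.comp (I' := I) (g := fun x => (e₀.coordChangeL ℝ e₁ x : F →L[ℝ] F))
      u₁ ?_ hsymm
    rw [hinv]
    exact (contMDiffAt_coordChangeL (IB := I) (n := ∞) hm' hn').mdifferentiableAt (by simp)
  have hτ : DifferentiableAt ℝ (fun u => extChartAt I x₀ ((extChartAt I x₁).symm u)) u₁ := by
    refine MDifferentiableAt.differentiableAt ?_
    refine MDifferentiableAt.comp (I' := I) (g := extChartAt I x₀) u₁ ?_ hsymm
    rw [hinv]
    exact mdifferentiableAt_extChartAt hm
  -- With `g` the transition function and `τ` the change of charts, the representations satisfy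
  -- `σ₁(u) = g(u) σ₀(τ u)`. The three maps are `g`, `Dτ` and `Dg` at the point, as they appear in
  -- the product rule.
  refine ⟨(e₀.coordChangeL ℝ e₁ m : F →L[ℝ] F),
    fderiv ℝ (fun u => extChartAt I x₀ ((extChartAt I x₁).symm u)) u₁,
    fderiv ℝ (fun u => (e₀.coordChangeL ℝ e₁ ((extChartAt I x₁).symm u) : F →L[ℝ] F)) u₁,
    fun j => ?_⟩
  obtain ⟨σ, rfl⟩ := jet_surjective j
  rw [coord_jet hm hm', coord_jet hn hn']
  have hcoord : ∀ x ∈ e₀.baseSet ∩ e₁.baseSet,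
      localRep F x₁ σ.1 x = e₀.coordChangeL ℝ e₁ x (localRep F x₀ σ.1 x) := by
    intro x hx
    rw [e₀.coordChangeL_apply e₁ hx]
    refine congrArg (fun p => (e₁ p).2) ?_
    refine (congrArg (TotalSpace.mk x) (e₀.symm_apply_apply_mk hx.1 (σ.1 x))).symm
  refine Prod.ext (hcoord m ⟨hm', hn'⟩) ?_
  have hev : chartRep I F x₁ σ.1 =ᶠ[𝓝 u₁] fun u =>
      e₀.coordChangeL ℝ e₁ ((extChartAt I x₁).symm u)
        (chartRep I F x₀ σ.1 (extChartAt I x₀ ((extChartAt I x₁).symm u))) := by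
    have h1 : Tendsto (extChartAt I x₁).symm (𝓝 u₁) (𝓝 m) := by
      have := hsymm.continuousAt
      rwa [ContinuousAt, hinv] at this
    filter_upwards [h1 (e₀.open_baseSet.mem_nhds hm'), h1 (e₁.open_baseSet.mem_nhds hn'),
      h1 ((chartAt HM x₀).open_source.mem_nhds hm)] with u h2 h3 h4
    refine (hcoord _ ⟨h2, h3⟩).trans (congrArg _ ?_)
    show _ = localRep F x₀ σ.1 ((extChartAt I x₀).symm (extChartAt I x₀ _))
    rw [(extChartAt I x₀).left_inv (by rwa [extChartAt_source])]
  have hrep : HasFDerivAt (chartRep I F x₀ σ.1)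
      (fderiv ℝ (chartRep I F x₀ σ.1) (extChartAt I x₀ m))
      (extChartAt I x₀ ((extChartAt I x₁).symm u₁)) := by
    rw [hinv]
    exact (differentiableAt_chartRep hm hm' σ).hasFDerivAt
  have hval : chartRep I F x₀ σ.1 (extChartAt I x₀ ((extChartAt I x₁).symm u₁)) =
      localRep F x₀ σ.1 m := by
    rw [hinv]
    show localRep F x₀ σ.1 ((extChartAt I x₀).symm (extChartAt I x₀ _)) = _
    rw [(extChartAt I x₀).left_inv (by rwa [extChartAt_source])]
  refine ((hcc.hasFDerivAt.clm_apply (HasFDerivAt.comp u₁ hrep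
    hτ.hasFDerivAt)).congr_of_eventuallyEq hev).fderiv.trans ?_
  rw [hinv] at hval
  simp only [Function.comp, hinv, hval]

/-- The fibre over `m` is topologized by the coordinates centred at `m`, and the change of
coordinates is continuous. This allows limits in nearby fibres to be read in one fixed chart, which
smoothness requires. -/
lemma Jet.continuous_coord {x₀ m : M} (hm : m ∈ (chartAt HM x₀).source)
    (hm' : m ∈ (trivializationAt F V x₀).baseSet) :
    Continuous fun j : Jet I F V m => j.coord x₀ := by
  obtain ⟨A, B, C, hABC⟩ := exists_coord_change (I := I) (F := F) (V := V) (mem_chart_source HM m)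
    (FiberBundle.mem_baseSet_trivializationAt' m) hm hm'
  have hc : Continuous fun j : Jet I F V m => j.coord m := continuous_induced_dom
  have h2 : Continuous fun c : F × (EM →L[ℝ] F) => (A c.1, A ∘L c.2 ∘L B + C.flip c.1) := by
    fun_prop
  exact (h2.comp hc).congr fun j => (hABC j).symm

lemma Jet.tendsto_nhds_iff {ι : Type*} {l : Filter ι} {m : M} {f : ι → Jet I F V m}
    {j : Jet I F V m} :
    Tendsto f l (𝓝 j) ↔ Tendsto (fun i => (f i).coord m) l (𝓝 (j.coord m)) := by
  rw [nhds_induced, tendsto_comap_iff]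
  rfl

end JetCoordinates

/-! ### The fibre derivative of a connection: existence, target, linearity. -/

section FibreDerivative

variable {EM : Type*} [NormedAddCommGroup EM] [NormedSpace ℝ EM]
  {HM : Type*} [TopologicalSpace HM] {I : ModelWithCorners ℝ EM HM} [I.Boundaryless]
  {M : Type*} [TopologicalSpace M] [ChartedSpace HM M]
  {F : Type*} [NormedAddCommGroup F] [NormedSpace ℝ F]
  {V : M → Type*} [TopologicalSpace (TotalSpace F V)]
  [∀ m, AddCommGroup (V m)] [∀ m, Module ℝ (V m)] [∀ m, TopologicalSpace (V m)]
  [FiberBundle F V] [VectorBundle ℝ F V] [IsManifold I ∞ M] [ContMDiffVectorBundle ∞ F V I]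

lemma trivializationAt_add_smul {x₀ m : M} (hm : m ∈ (trivializationAt F V x₀).baseSet)
    (a b : V m) (s : ℝ) :
    (trivializationAt F V x₀ ⟨m, a + s • b⟩).2 =
      (trivializationAt F V x₀ ⟨m, a⟩).2 + s • (trivializationAt F V x₀ ⟨m, b⟩).2 := by
  have hl := (trivializationAt F V x₀).linear ℝ hm
  rw [hl.map_add, hl.map_smul]

lemma Jet.coord_add_smul {x₀ m : M} (hm : m ∈ (chartAt HM x₀).source)
    (hm' : m ∈ (trivializationAt F V x₀).baseSet) (j k : Jet I F V m) (s : ℝ) :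
    (j + s • k).coord x₀ = j.coord x₀ + s • k.coord x₀ := by
  rw [coord_add hm hm', coord_smul hm hm']

lemma Jet.coord_slope {x₀ m : M} (hm : m ∈ (chartAt HM x₀).source)
    (hm' : m ∈ (trivializationAt F V x₀).baseSet) (s : ℝ) (j k : Jet I F V m) :
    (s • (j - k)).coord x₀ = s • (j.coord x₀ - k.coord x₀) :=
  ((coordLinear hm hm').map_smul s (j - k)).trans
    (congrArg (s • ·) ((coordLinear hm hm').map_sub j k))

namespace Connection

variable (h : Connection I F V)

/-- The coordinate expression of `h`, restricted to one fibre, is a differentiable map on `F`, and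
`D` is its Fréchet derivative at `a`. That one `D` serves all directions `b` is the source of
linearity. -/
lemma exists_hasDerivAt_coord_toFun {m : M} (a : V m) :
    ∃ D : F →L[ℝ] F × (EM →L[ℝ] F), ∀ b : V m,
      HasDerivAt (fun s : ℝ => (h.toFun m (a + s • b)).coord m)
        (D (trivializationAt F V m ⟨m, b⟩).2) 0 := by
  set e := trivializationAt F V m with he
  have hm : m ∈ e.baseSet := FiberBundle.mem_baseSet_trivializationAt' m
  have hinc : ContMDiff 𝓘(ℝ, F) (I.prod 𝓘(ℝ, F)) ∞
      (fun y : F => (⟨m, e.symm m y⟩ : TotalSpace F V)) := by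
    refine (e.contMDiff_iff (fun y => e.mem_source.2 hm)).2 ⟨contMDiff_const, ?_⟩
    exact contMDiff_id.congr fun y => congrArg Prod.snd (e.apply_mk_symm hm y)
  have hsymm : ∀ b : V m, e.symm m (e ⟨m, b⟩).2 = b := fun b => e.symm_apply_apply_mk hm b
  have hd : DifferentiableAt ℝ (fun y : F => (h.toFun m (e.symm m y)).coord m) (e ⟨m, a⟩).2 := by
    have h1 := h.smooth ⟨m, a⟩
    have h2 : ContMDiffAt 𝓘(ℝ, F) 𝓘(ℝ, F × (EM →L[ℝ] F)) ∞
        ((fun q : TotalSpace F V => (h.toFun q.proj q.2).coord m) ∘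
          fun y : F => (⟨m, e.symm m y⟩ : TotalSpace F V)) (e ⟨m, a⟩).2 := by
      refine ContMDiffAt.comp _ ?_ hinc.contMDiffAt
      rw [hsymm]
      exact h1
    exact h2.contDiffAt.differentiableAt (by simp)
  refine ⟨fderiv ℝ (fun y : F => (h.toFun m (e.symm m y)).coord m) (e ⟨m, a⟩).2, fun b => ?_⟩
  have hl : HasDerivAt (fun s : ℝ => (e ⟨m, a⟩).2 + s • (e ⟨m, b⟩).2) (e ⟨m, b⟩).2 0 := by
    simpa using ((hasDerivAt_id (0 : ℝ)).smul_const (e ⟨m, b⟩).2).const_add (e ⟨m, a⟩).2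
  have hd' := hd.hasFDerivAt
  rw [show (e ⟨m, a⟩).2 = (e ⟨m, a⟩).2 + (0 : ℝ) • (e ⟨m, b⟩).2 by simp] at hd'
  have := hd'.comp_hasDerivAt 0 hl
  simp only [zero_smul, add_zero] at this
  refine this.congr_of_eventuallyEq (Eventually.of_forall fun s => ?_)
  show _ = (h.toFun m (e.symm m ((e ⟨m, a⟩).2 + s • (e ⟨m, b⟩).2))).coord m
  rw [← trivializationAt_add_smul hm, ← he, hsymm]

/-- The derivative of a connection along the fibre at `a`, in the direction `b`. -/
def fibreDerivJet {m : M} (a b : V m) : Jet I F V m :=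
  limUnder (𝓝[≠] (0 : ℝ)) fun s => s⁻¹ • (h.toFun m (a + s • b) - h.toFun m a)

/-- The difference quotients converge in the coordinates centred at `m`, and `affineSection`
supplies a jet with the limiting coordinates. Uniqueness of limits in the jet fibre is not needed:
`limUnder` selects some limit, and later its coordinates are pinned down by uniqueness of
derivatives. -/
lemma tendsto_fibreDerivJet {m : M} (a b : V m) :
    Tendsto (fun s : ℝ => s⁻¹ • (h.toFun m (a + s • b) - h.toFun m a)) (𝓝[≠] 0)
      (𝓝 (h.fibreDerivJet a b)) := by
  refine tendsto_nhds_limUnder ?_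
  obtain ⟨D, hD⟩ := h.exists_hasDerivAt_coord_toFun a
  refine ⟨jet (affineSection I F V m (D (trivializationAt F V m ⟨m, b⟩).2)),
    Jet.tendsto_nhds_iff.2 ?_⟩
  rw [Jet.coord_affineSection]
  have := hasDerivAt_iff_tendsto_slope_zero.1 (hD b)
  simp only [zero_add, zero_smul, add_zero] at this
  refine this.congr fun s => (Jet.coord_slope (mem_chart_source HM m)
    (FiberBundle.mem_baseSet_trivializationAt' m) _ _ _).symm

lemma hasDerivAt_coord_toFun {x₀ m : M} (hm : m ∈ (chartAt HM x₀).source)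
    (hm' : m ∈ (trivializationAt F V x₀).baseSet) (a b : V m) :
    HasDerivAt (fun s : ℝ => (h.toFun m (a + s • b)).coord x₀)
      ((h.fibreDerivJet a b).coord x₀) 0 := by
  rw [hasDerivAt_iff_tendsto_slope_zero]
  simp only [zero_add, zero_smul, add_zero]
  refine (((Jet.continuous_coord hm hm').tendsto _).comp (h.tendsto_fibreDerivJet a b)).congr
    fun s => Jet.coord_slope hm hm' _ _ _

/-- As `h` is a section, the first coordinate of `h(a + sb)` is that of `a + sb`, affine in `s` with
slope the coordinate of `b`. -/
lemma target_fibreDerivJet {m : M} (a b : V m) : (h.fibreDerivJet a b).target = b := by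
  have hm' := FiberBundle.mem_baseSet_trivializationAt' (F := F) (E := V) m
  have hm := mem_chart_source HM m
  have h1 : HasDerivAt (fun s : ℝ => ((h.toFun m (a + s • b)).coord m).1)
      ((h.fibreDerivJet a b).coord m).1 0 := (h.hasDerivAt_coord_toFun hm hm' a b).fst
  have h2 : HasDerivAt (fun s : ℝ => ((h.toFun m (a + s • b)).coord m).1)
      (trivializationAt F V m ⟨m, b⟩).2 0 := by
    simp only [Jet.coord_fst hm hm', h.target_toFun, trivializationAt_add_smul hm']
    simpa using ((hasDerivAt_id (0 : ℝ)).smul_const (trivializationAt F V m ⟨m, b⟩).2).const_add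
      (trivializationAt F V m ⟨m, a⟩).2
  have h3 := h1.unique h2
  rw [Jet.coord_fst hm hm'] at h3
  rw [← (trivializationAt F V m).symm_apply_apply_mk hm' (h.fibreDerivJet a b).target, h3,
    (trivializationAt F V m).symm_apply_apply_mk hm']

lemma isLinearMap_fibreDerivJet {m : M} (a : V m) : IsLinearMap ℝ (h.fibreDerivJet a) := by
  have hm' := FiberBundle.mem_baseSet_trivializationAt' (F := F) (E := V) m
  have hm := mem_chart_source HM m
  obtain ⟨D, hD⟩ := h.exists_hasDerivAt_coord_toFun a
  have key : ∀ b, (h.fibreDerivJet a b).coord m = D (trivializationAt F V m ⟨m, b⟩).2 := fun b =>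
    (h.hasDerivAt_coord_toFun hm hm' a b).unique (hD b)
  have hl := (trivializationAt F V m).linear ℝ hm'
  constructor
  · intro b c
    refine Jet.coord_injective hm hm' ?_
    show Jet.coord m _ = Jet.coord m _
    rw [Jet.coord_add hm hm', key, key, key, hl.map_add, map_add]
  · intro t b
    refine Jet.coord_injective hm hm' ?_
    show Jet.coord m _ = Jet.coord m _
    rw [Jet.coord_smul hm hm', key, key, hl.map_smul, map_smul]

end Connection

/-! ### Smoothness of the fibre derivative and the connection it induces on the pullback bundle. -/

lemma mem_chartAt_totalSpace_source {a q : TotalSpace F V}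
    (hq : q.proj ∈ (chartAt HM a.proj).source)
    (hq' : q.proj ∈ (trivializationAt F V a.proj).baseSet) :
    q ∈ (chartAt (ModelProd HM F) a).source := by
  rw [FiberBundle.chartedSpace_chartAt]
  have h1 : (trivializationAt F V a.proj q).1 ∈ (chartAt HM a.proj).source := by
    rwa [(trivializationAt F V a.proj).coe_fst' hq']
  exact ⟨(trivializationAt F V a.proj).mem_source.2 hq', h1, mem_univ _⟩

lemma extChartAt_totalSpace_apply {a q : TotalSpace F V}
    (hq' : q.proj ∈ (trivializationAt F V a.proj).baseSet) :
    extChartAt (I.prod 𝓘(ℝ, F)) a q =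
      (extChartAt I a.proj q.proj, (trivializationAt F V a.proj q).2) := by
  rw [FiberBundle.extChartAt]
  refine Prod.ext ?_ rfl
  exact congrArg (extChartAt I a.proj) ((trivializationAt F V a.proj).coe_fst' hq')

lemma proj_extChartAt_totalSpace_symm {a : TotalSpace F V} {u : EM × F}
    (hu : u ∈ (extChartAt (I.prod 𝓘(ℝ, F)) a).target) :
    ((extChartAt (I.prod 𝓘(ℝ, F)) a).symm u).proj = (extChartAt I a.proj).symm u.1 := by
  rw [FiberBundle.extChartAt_target] at hu
  rw [FiberBundle.extChartAt]
  exact (trivializationAt F V a.proj).proj_symm_apply' hu.1.2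

/-- The section `ισ` does not depend on the fibre coordinate of `E`: in the product chart of `E` its
representation is that of `σ` composed with `EM × F → EM`. -/
lemma coord_canonicalImmersion {a q : TotalSpace F V}
    (hq : q.proj ∈ (chartAt HM a.proj).source)
    (hq' : q.proj ∈ (trivializationAt F V a.proj).baseSet) (j : Jet I F V q.proj) :
    (canonicalImmersion I F V q j).coord a =
      ((j.coord a.proj).1, (j.coord a.proj).2 ∘L ContinuousLinearMap.fst ℝ EM F) := by
  obtain ⟨σ, rfl⟩ := jet_surjective j
  have hs := mem_chartAt_totalSpace_source hq hq'
  have h1 : canonicalImmersion I F V q (jet σ) = jet (pullbackLocalSection I F V q σ) := rfl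
  rw [h1, Jet.coord_jet hs hq', Jet.coord_jet hq hq']
  refine Prod.ext rfl ?_
  have hψ := extChartAt_totalSpace_apply (I := I) hq'
  have hev : chartRep (I.prod 𝓘(ℝ, F)) F a (pullbackLocalSection I F V q σ).1
      =ᶠ[𝓝 (extChartAt (I.prod 𝓘(ℝ, F)) a q)]
        chartRep I F a.proj σ.1 ∘ (Prod.fst : EM × F → EM) := by
    filter_upwards [(isOpen_extChartAt_target (I := I.prod 𝓘(ℝ, F)) a).mem_nhds
      ((extChartAt (I.prod 𝓘(ℝ, F)) a).map_source (by rwa [extChartAt_source]))] with u hu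
    exact congrArg (localRep F a.proj σ.1) (proj_extChartAt_totalSpace_symm hu)
  have hd : HasFDerivAt (chartRep I F a.proj σ.1)
      (fderiv ℝ (chartRep I F a.proj σ.1) (extChartAt I a.proj q.proj))
      (extChartAt (I.prod 𝓘(ℝ, F)) a q).1 := by
    rw [hψ]
    exact (differentiableAt_chartRep hq hq' σ).hasFDerivAt
  exact ((hd.comp _ hasFDerivAt_fst).congr_of_eventuallyEq hev).fderiv

namespace Connection

variable (h : Connection I F V)

/-- With `g` the expression of `h` in the chart of `E`, the fibre derivative has coordinates `Dg(x,
y)(0, z)`, smooth because `Dg` is. -/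
lemma contMDiffAt_coord_fibreDerivJet (p : PullbackSpace I F V) :
    ContMDiffAt ((I.prod 𝓘(ℝ, F)).prod 𝓘(ℝ, F)) 𝓘(ℝ, F × (EM →L[ℝ] F)) ∞
      (fun q : PullbackSpace I F V =>
        (h.fibreDerivJet (m := q.proj.proj) q.proj.2 q.2).coord p.proj.proj) p := by
  set a := p.proj with ha
  set e := trivializationAt F V a.proj with he
  set ψ := extChartAt (I.prod 𝓘(ℝ, F)) a with hψ
  set g : EM × F → F × (EM →L[ℝ] F) :=
    (fun q : TotalSpace F V => (h.toFun q.proj q.2).coord a.proj) ∘ ψ.symm with hg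
  have hgs : ContDiffAt ℝ ∞ g (ψ a) := by
    refine ContMDiffAt.contDiffAt ?_
    refine ContMDiffAt.comp (I' := I.prod 𝓘(ℝ, F)) (ψ a) ?_ ?_
    · rw [hψ, extChartAt_to_inv]
      exact h.smooth a
    · exact (contMDiffOn_extChartAt_symm (n := ∞) a).contMDiffAt
        (extChartAt_target_mem_nhds a)
  have hψs : ContMDiffAt (I.prod 𝓘(ℝ, F)) 𝓘(ℝ, EM × F) ∞ ψ a := contMDiffAt_extChartAt
  have hproj : ContMDiffAt ((I.prod 𝓘(ℝ, F)).prod 𝓘(ℝ, F)) (I.prod 𝓘(ℝ, F)) ∞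
      (TotalSpace.proj : PullbackSpace I F V → TotalSpace F V) p :=
    contMDiffAt_proj (PullbackFibre I F V)
  have hy : ContMDiffAt ((I.prod 𝓘(ℝ, F)).prod 𝓘(ℝ, F)) 𝓘(ℝ, F) ∞
      (fun q : PullbackSpace I F V => (e ⟨q.proj.proj, q.2⟩).2) p := by
    have h1 : ContMDiffAt ((I.prod 𝓘(ℝ, F)).prod 𝓘(ℝ, F)) ((I.prod 𝓘(ℝ, F)).prod 𝓘(ℝ, F)) ∞
        (trivializationAt F (PullbackFibre I F V) a) p :=
      ((trivializationAt F (PullbackFibre I F V) a).contMDiffOn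
        (IB := I.prod 𝓘(ℝ, F)) (n := ∞)).contMDiffAt
        ((trivializationAt F (PullbackFibre I F V) a).open_source.mem_nhds
          (FiberBundle.mem_trivializationAt_proj_source (x := p)))
    exact h1.snd
  have hev : (fun q : PullbackSpace I F V =>
        (h.fibreDerivJet (m := q.proj.proj) q.proj.2 q.2).coord a.proj) =ᶠ[𝓝 p]
      fun q => fderiv ℝ g (ψ q.proj) ((0 : EM), (e ⟨q.proj.proj, q.2⟩).2) := by
    -- Differentiability is needed at all nearby points. `ContDiffAt.eventually` excludes order `∞`,
    -- hence the passage to order 1.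
    have hd : ∀ᶠ u in 𝓝 (ψ a), DifferentiableAt ℝ g u :=
      ((hgs.of_le (m := 1) (by simp)).eventually (by simp)).mono fun u hu =>
        hu.differentiableAt (by simp)
    have hb : ∀ᶠ q : TotalSpace F V in 𝓝 a, q.proj ∈ (chartAt HM a.proj).source ∧
        q.proj ∈ e.baseSet := by
      have hc : Tendsto (TotalSpace.proj : TotalSpace F V → M) (𝓝 a) (𝓝 a.proj) :=
        (FiberBundle.continuous_proj F V).continuousAt
      exact (hc.eventually ((chartAt HM a.proj).open_source.mem_nhds
        (mem_chart_source HM a.proj))).and (hc.eventually (e.open_baseSet.mem_nhds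
        (FiberBundle.mem_baseSet_trivializationAt' a.proj)))
    filter_upwards [hproj.continuousAt.eventually hb,
      hproj.continuousAt.eventually (hψs.continuousAt.eventually hd)] with q hq hqd
    obtain ⟨⟨m, y⟩, z⟩ := q
    change V m at z
    obtain ⟨hq1, hq2⟩ := hq
    change m ∈ _ at hq1
    change m ∈ _ at hq2
    change DifferentiableAt ℝ g (ψ ⟨m, y⟩) at hqd
    refine (h.hasDerivAt_coord_toFun hq1 hq2 y z).unique ?_
    have hline : HasDerivAt (fun s : ℝ => ψ (⟨m, y⟩ : TotalSpace F V) +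
        s • ((0 : EM), (e ⟨m, z⟩).2)) ((0 : EM), (e ⟨m, z⟩).2) 0 := by
      simpa using ((hasDerivAt_id (0 : ℝ)).smul_const ((0 : EM), (e ⟨m, z⟩).2)).const_add
        (ψ (⟨m, y⟩ : TotalSpace F V))
    have hqd' := hqd.hasFDerivAt
    rw [show ψ (⟨m, y⟩ : TotalSpace F V) = ψ (⟨m, y⟩ : TotalSpace F V) +
      (0 : ℝ) • ((0 : EM), (e ⟨m, z⟩).2) by simp] at hqd'
    have hcomp := hqd'.comp_hasDerivAt 0 hline
    simp only [zero_smul, add_zero] at hcomp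
    refine hcomp.congr_of_eventuallyEq (Eventually.of_forall fun s => ?_)
    -- The chart of `E` is affine on fibres, so the line `y + sz` becomes a straight line in the
    -- direction `(0, z)`.
    have hsum : ψ (⟨m, y⟩ : TotalSpace F V) + s • ((0 : EM), (e ⟨m, z⟩).2) =
        ψ (⟨m, y + s • z⟩ : TotalSpace F V) := by
      rw [hψ, extChartAt_totalSpace_apply (I := I) (q := ⟨m, y⟩) hq2,
        extChartAt_totalSpace_apply (I := I) (q := ⟨m, y + s • z⟩) hq2,
        trivializationAt_add_smul hq2]
      simp [he]
    show _ = g (ψ (⟨m, y⟩ : TotalSpace F V) + s • ((0 : EM), (e ⟨m, z⟩).2))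
    rw [hsum]
    show _ = (fun q : TotalSpace F V => (h.toFun q.proj q.2).coord a.proj) (ψ.symm (ψ _))
    rw [ψ.left_inv]
    rw [hψ, extChartAt_source]
    exact mem_chartAt_totalSpace_source (q := ⟨m, y + s • z⟩) hq1 hq2
  refine ContMDiffAt.congr_of_eventuallyEq ?_ hev
  have hfd : ContDiffAt ℝ ∞ (fderiv ℝ g) (ψ a) := hgs.fderiv_right (by simp)
  have h1 : ContMDiffAt ((I.prod 𝓘(ℝ, F)).prod 𝓘(ℝ, F))
      𝓘(ℝ, (EM × F) →L[ℝ] F × (EM →L[ℝ] F)) ∞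
      (fun q : PullbackSpace I F V => fderiv ℝ g (ψ q.proj)) p :=
    hfd.contMDiffAt.comp p (hψs.comp p hproj)
  have h2 : ContMDiffAt ((I.prod 𝓘(ℝ, F)).prod 𝓘(ℝ, F)) 𝓘(ℝ, EM × F) ∞
      (fun q : PullbackSpace I F V => ((0 : EM), (e ⟨q.proj.proj, q.2⟩).2)) p :=
    contMDiffAt_const.prodMk_space hy
  exact h1.clm_apply h2

/-- The connection on `π^*π` with values `j¹_a (ι η)`, where `j¹ η` is the fibre derivative
of `h`. -/
def pullbackDeriv : Connection (I.prod 𝓘(ℝ, F)) F (PullbackFibre I F V) where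
  toFun a b := canonicalImmersion I F V a (h.fibreDerivJet a.2 b)
  target_toFun a b := by
    obtain ⟨σ, hσ⟩ := jet_surjective (h.fibreDerivJet (m := a.proj) a.2 b)
    have h1 := h.target_fibreDerivJet (m := a.proj) a.2 b
    rw [← hσ] at h1
    rw [← hσ]
    exact h1
  smooth p := by
    have h1 := h.contMDiffAt_coord_fibreDerivJet p
    have h2 : ContMDiffAt ((I.prod 𝓘(ℝ, F)).prod 𝓘(ℝ, F))
        𝓘(ℝ, F × ((EM × F) →L[ℝ] F)) ∞
        (fun q : PullbackSpace I F V =>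
          ((((h.fibreDerivJet (m := q.proj.proj) q.proj.2 q.2).coord p.proj.proj).1,
            ((h.fibreDerivJet (m := q.proj.proj) q.proj.2 q.2).coord p.proj.proj).2 ∘L
              ContinuousLinearMap.fst ℝ EM F) : F × ((EM × F) →L[ℝ] F))) p := by
      have h3 : ContDiff ℝ ∞ fun c : F × (EM →L[ℝ] F) =>
          (c.1, c.2 ∘L ContinuousLinearMap.fst ℝ EM F) := by fun_prop
      exact h3.contMDiff.contMDiffAt.comp p h1
    refine h2.congr_of_eventuallyEq ?_
    have hc : Tendsto (fun q : PullbackSpace I F V => q.proj.proj) (𝓝 p) (𝓝 p.proj.proj) :=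
      ((FiberBundle.continuous_proj F V).comp
        (FiberBundle.continuous_proj F (PullbackFibre I F V))).continuousAt
    filter_upwards [hc ((chartAt HM p.proj.proj).open_source.mem_nhds
      (mem_chart_source HM p.proj.proj)), hc ((trivializationAt F V p.proj.proj).open_baseSet.mem_nhds
        (FiberBundle.mem_baseSet_trivializationAt' p.proj.proj))] with q hq hq'
    exact coord_canonicalImmersion hq hq' _

/-- `Ψ` places its value over the target of `h(a)`, which equals `a` only propositionally; the
equality is transported along `target_toFun`. -/
lemma toMap_pullbackDeriv :
    h.pullbackDeriv.toMap = jetMap ∘ fibreDeriv h.toFun := by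
  funext p
  exact (congrArg (fun t : V p.proj.proj => (⟨⟨p.proj.proj, t⟩,
    canonicalImmersion I F V ⟨p.proj.proj, t⟩ (h.fibreDerivJet (m := p.proj.proj) p.proj.2 p.2)⟩ :
      JetSpace (I.prod 𝓘(ℝ, F)) F (PullbackFibre I F V)))
    (h.target_toFun p.proj.proj p.proj.2)).symm

lemma isLinear_pullbackDeriv : h.pullbackDeriv.IsLinear := by
  intro a
  have hl := h.isLinearMap_fibreDerivJet (m := a.proj) a.2
  exact ⟨fun b c => (congrArg (canonicalImmersion I F V a) (hl.map_add b c)).trans (map_add _ _ _),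
    fun t b => (congrArg (canonicalImmersion I F V a) (hl.map_smul t b)).trans (map_smul _ _ _)⟩

end Connection

end FibreDerivative

/-! ### The tangent bundle of `E` in a trivialization, and velocities of curves in it. -/

lemma contMDiffAt_tangentMap_of_isOpen {E₁ H₁ M₁ E₂ H₂ M₂ : Type*} [NormedAddCommGroup E₁]
    [NormedSpace ℝ E₁] [TopologicalSpace H₁] {I₁ : ModelWithCorners ℝ E₁ H₁} [TopologicalSpace M₁]
    [ChartedSpace H₁ M₁] [IsManifold I₁ ∞ M₁] [NormedAddCommGroup E₂] [NormedSpace ℝ E₂]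
    [TopologicalSpace H₂] {I₂ : ModelWithCorners ℝ E₂ H₂} [TopologicalSpace M₂] [ChartedSpace H₂ M₂]
    [IsManifold I₂ ∞ M₂] {f : M₁ → M₂} {s : Set M₁} (hs : IsOpen s) (hf : ContMDiffOn I₁ I₂ ∞ f s)
    {X : TangentBundle I₁ M₁} (hX : X.proj ∈ s) :
    ContMDiffAt I₁.tangent I₂.tangent ∞ (tangentMap I₁ I₂ f) X := by
  have : IsManifold I₁ 1 M₁ := IsManifold.of_le (n := ∞) (by simp)
  have : IsManifold I₂ 1 M₂ := IsManifold.of_le (n := ∞) (by simp)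
  have ho : IsOpen (TotalSpace.proj ⁻¹' s : Set (TangentBundle I₁ M₁)) :=
    hs.preimage (FiberBundle.continuous_proj E₁ (TangentSpace I₁))
  have h1 := hf.contMDiffOn_tangentMapWithin (m := ∞) (by simp) hs.uniqueMDiffOn
  refine (h1.congr fun Y hY => ?_).contMDiffAt (ho.mem_nhds hX)
  exact (tangentMapWithin_eq_tangentMap (hs.uniqueMDiffOn _ hY)
    (((hf.contMDiffAt (hs.mem_nhds hY))).mdifferentiableAt (by simp))).symm

section TangentCoordinates

variable {EM : Type*} [NormedAddCommGroup EM] [NormedSpace ℝ EM]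
  {HM : Type*} [TopologicalSpace HM] {I : ModelWithCorners ℝ EM HM}
  {M : Type*} [TopologicalSpace M] [ChartedSpace HM M]
  {F : Type*} [NormedAddCommGroup F] [NormedSpace ℝ F]
  {V : M → Type*} [TopologicalSpace (TotalSpace F V)]
  [∀ m, AddCommGroup (V m)] [∀ m, Module ℝ (V m)] [∀ m, TopologicalSpace (V m)]
  [FiberBundle F V] [VectorBundle ℝ F V] [IsManifold I ∞ M] [ContMDiffVectorBundle ∞ F V I]

variable (F V) in
/-- The tangent vector of `E` lying over `w ∈ TM` whose vertical components, in the trivialization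
at `x₀`, are `c = (y, ẏ)`. -/
def tangentLift (x₀ : M) (w : TangentBundle I M) (c : F × F) :
    TangentBundle (I.prod 𝓘(ℝ, F)) (TotalSpace F V) :=
  tangentMap (I.prod 𝓘(ℝ, F)) (I.prod 𝓘(ℝ, F)) (trivializationAt F V x₀).toOpenPartialHomeomorph.symm
    ⟨(w.proj, c.1), (w.2, c.2)⟩

/-- The vertical components `(y, ẏ)` of a tangent vector of `E`, in the trivialization at `x₀`. -/
def tangentFibreCoord (x₀ : M) (X : TangentBundle (I.prod 𝓘(ℝ, F)) (TotalSpace F V)) : F × F :=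
  ((trivializationAt F V x₀ X.proj).2,
    mfderiv (I.prod 𝓘(ℝ, F)) 𝓘(ℝ, F) (fun q => (trivializationAt F V x₀ q).2) X.proj X.2)

lemma contMDiffOn_fibreCoord (x₀ : M) :
    ContMDiffOn (I.prod 𝓘(ℝ, F)) 𝓘(ℝ, F) ∞
      (fun q : TotalSpace F V => (trivializationAt F V x₀ q).2) (trivializationAt F V x₀).source :=
  fun q hq => ((trivializationAt F V x₀).contMDiffOn (IB := I) (n := ∞) q hq).snd

lemma contMDiff_tangentBundle_mk :
    ContMDiff 𝓘(ℝ, F × F) 𝓘(ℝ, F).tangent ∞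
      (fun c : F × F => (⟨c.1, c.2⟩ : TangentBundle 𝓘(ℝ, F) F)) := by
  intro c
  refine contMDiffAt_totalSpace.2 ⟨contDiff_fst.contMDiff.contMDiffAt, ?_⟩
  refine contDiff_snd.contMDiff.contMDiffAt.congr_of_eventuallyEq (Eventually.of_forall fun d => ?_)
  simp [trivializationAt_model_space_apply]

lemma contMDiff_tangentLift {x₀ : M} {w : TangentBundle I M}
    (hw : w.proj ∈ (trivializationAt F V x₀).baseSet) :
    ContMDiff 𝓘(ℝ, F × F) (I.prod 𝓘(ℝ, F)).tangent ∞ (tangentLift F V x₀ w) := by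
  have : IsManifold I 1 M := IsManifold.of_le (n := ∞) (by simp)
  intro c
  have h1 : ContMDiff 𝓘(ℝ, F × F) (I.prod 𝓘(ℝ, F)).tangent ∞
      (fun c : F × F => (equivTangentBundleProd I M 𝓘(ℝ, F) F).symm (w, ⟨c.1, c.2⟩)) :=
    contMDiff_equivTangentBundleProd_symm.comp (contMDiff_const.prodMk contMDiff_tangentBundle_mk)
  exact (contMDiffAt_tangentMap_of_isOpen (trivializationAt F V x₀).open_target
    ((trivializationAt F V x₀).contMDiffOn_symm (IB := I) (n := ∞))
    (X := (equivTangentBundleProd I M 𝓘(ℝ, F) F).symm (w, ⟨c.1, c.2⟩))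
    ((trivializationAt F V x₀).mem_target.2 hw)).comp c h1.contMDiffAt

lemma contMDiffAt_tangentFibreCoord {x₀ : M}
    {X : TangentBundle (I.prod 𝓘(ℝ, F)) (TotalSpace F V)}
    (hX : X.proj.proj ∈ (trivializationAt F V x₀).baseSet) :
    ContMDiffAt (I.prod 𝓘(ℝ, F)).tangent 𝓘(ℝ, F × F) ∞ (tangentFibreCoord x₀) X := by
  have h1 : ContMDiffAt (I.prod 𝓘(ℝ, F)).tangent 𝓘(ℝ, F).tangent ∞
      (tangentMap (I.prod 𝓘(ℝ, F)) 𝓘(ℝ, F)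
        (fun q : TotalSpace F V => (trivializationAt F V x₀ q).2)) X :=
    contMDiffAt_tangentMap_of_isOpen (trivializationAt F V x₀).open_source
      (contMDiffOn_fibreCoord x₀) ((trivializationAt F V x₀).mem_source.2 hX)
  have h2 := (contMDiff_proj (n := ∞) (IB := 𝓘(ℝ, F)) (TangentSpace 𝓘(ℝ, F) (M := F))).contMDiffAt.comp X h1
  have h3 := (contMDiff_snd_tangentBundle_modelSpace (n := ∞) F 𝓘(ℝ, F)).contMDiffAt.comp X h1
  exact h2.prodMk_space h3

lemma mdifferentiableAt_trivializationAt_symm {x₀ : M} {z : M × F}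
    (hz : z.1 ∈ (trivializationAt F V x₀).baseSet) :
    MDifferentiableAt (I.prod 𝓘(ℝ, F)) (I.prod 𝓘(ℝ, F))
      (trivializationAt F V x₀).toOpenPartialHomeomorph.symm z :=
  (((trivializationAt F V x₀).contMDiffOn_symm (IB := I) (n := ∞)).contMDiffAt
    ((trivializationAt F V x₀).open_target.mem_nhds
      ((trivializationAt F V x₀).mem_target.2 hz))).mdifferentiableAt (by simp)

lemma mdifferentiableAt_fibreCoord {x₀ : M} {q : TotalSpace F V}
    (hq : q.proj ∈ (trivializationAt F V x₀).baseSet) :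
    MDifferentiableAt (I.prod 𝓘(ℝ, F)) 𝓘(ℝ, F)
      (fun q : TotalSpace F V => (trivializationAt F V x₀ q).2) q :=
  ((contMDiffOn_fibreCoord x₀).contMDiffAt ((trivializationAt F V x₀).open_source.mem_nhds
    ((trivializationAt F V x₀).mem_source.2 hq))).mdifferentiableAt (by simp)

lemma tangentFibreCoord_tangentLift {x₀ : M} {w : TangentBundle I M}
    (hw : w.proj ∈ (trivializationAt F V x₀).baseSet) (c : F × F) :
    tangentFibreCoord x₀ (tangentLift F V x₀ w c) = c := by
  set e := trivializationAt F V x₀ with he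
  have ht : (w.proj, c.1) ∈ e.target := e.mem_target.2 hw
  have hev : (fun q => (e q).2) ∘ e.toOpenPartialHomeomorph.symm =ᶠ[𝓝 (w.proj, c.1)] Prod.snd := by
    filter_upwards [e.open_target.mem_nhds ht] with z hz
    exact congrArg Prod.snd (e.apply_symm_apply hz)
  have h1 : MDifferentiableAt (I.prod 𝓘(ℝ, F)) 𝓘(ℝ, F) (fun q => (e q).2)
      (e.toOpenPartialHomeomorph.symm (w.proj, c.1)) := by
    refine mdifferentiableAt_fibreCoord ?_
    rwa [e.proj_symm_apply ht]
  have h2 := tangentMap_comp_at (I := I.prod 𝓘(ℝ, F)) (I' := I.prod 𝓘(ℝ, F)) (I'' := 𝓘(ℝ, F))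
    (⟨(w.proj, c.1), (w.2, c.2)⟩ : TangentBundle (I.prod 𝓘(ℝ, F)) (M × F)) h1
    (mdifferentiableAt_trivializationAt_symm hw)
  have h3 : tangentMap (I.prod 𝓘(ℝ, F)) 𝓘(ℝ, F) (Prod.snd : M × F → F)
      ⟨(w.proj, c.1), (w.2, c.2)⟩ = _ := (tangentMap_congr hev _).symm.trans h2
  rw [tangentMap_prodSnd] at h3
  exact Prod.ext (congrArg (fun p : TangentBundle 𝓘(ℝ, F) F => p.proj) h3).symm
    (congrArg (fun p : TangentBundle 𝓘(ℝ, F) F => (p.2 : F)) h3).symm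

/-- The tangent map of a map into `E` in a trivialization. -/
lemma tangentMap_eq_tangentLift {EN HN N : Type*} [NormedAddCommGroup EN] [NormedSpace ℝ EN]
    [TopologicalSpace HN] {J : ModelWithCorners ℝ EN HN} [TopologicalSpace N] [ChartedSpace HN N]
    {f : N → TotalSpace F V} {x₀ : M} {u : TangentBundle J N}
    (hf : MDifferentiableAt J (I.prod 𝓘(ℝ, F)) f u.proj)
    (hb : (f u.proj).proj ∈ (trivializationAt F V x₀).baseSet) :
    tangentMap J (I.prod 𝓘(ℝ, F)) f u =
      tangentLift F V x₀ (tangentMap J I (fun x => (f x).proj) u)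
        ((trivializationAt F V x₀ (f u.proj)).2,
          mfderiv J 𝓘(ℝ, F) (fun x => (trivializationAt F V x₀ (f x)).2) u.proj u.2) := by
  obtain ⟨n, v⟩ := u
  set e := trivializationAt F V x₀ with he
  have h1 : MDifferentiableAt J I (fun x => (f x).proj) n :=
    MDifferentiableAt.comp (I' := I.prod 𝓘(ℝ, F)) (g := (TotalSpace.proj : TotalSpace F V → M)) n
      (mdifferentiableAt_proj V) hf
  have h2 : MDifferentiableAt J 𝓘(ℝ, F) (fun x => (e (f x)).2) n :=
    MDifferentiableAt.comp (I' := I.prod 𝓘(ℝ, F)) (g := fun q : TotalSpace F V => (e q).2) n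
      (mdifferentiableAt_fibreCoord hb) hf
  have hev : f =ᶠ[𝓝 n] e.toOpenPartialHomeomorph.symm ∘ (fun x => ((f x).proj, (e (f x)).2)) := by
    filter_upwards [hf.continuousAt (e.open_source.mem_nhds (e.mem_source.2 hb))] with x hx
    show _ = e.toOpenPartialHomeomorph.symm ((f x).proj, (e (f x)).2)
    rw [e.mk_proj_snd hx]
    exact (e.toOpenPartialHomeomorph.left_inv hx).symm
  have hm2 : (mfderiv J (I.prod 𝓘(ℝ, F)) (fun x => ((f x).proj, (e (f x)).2)) n v : EM × F) =
      ((mfderiv J I (fun x => (f x).proj) n v : EM),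
        (mfderiv J 𝓘(ℝ, F) (fun x => (e (f x)).2) n v : F)) :=
    DFunLike.congr_fun (h1.hasMFDerivAt.prodMk h2.hasMFDerivAt).mfderiv v
  calc tangentMap J (I.prod 𝓘(ℝ, F)) f ⟨n, v⟩
      = tangentMap J (I.prod 𝓘(ℝ, F))
        (e.toOpenPartialHomeomorph.symm ∘ (fun x => ((f x).proj, (e (f x)).2))) ⟨n, v⟩ :=
        tangentMap_congr hev v
    _ = tangentMap (I.prod 𝓘(ℝ, F)) (I.prod 𝓘(ℝ, F)) e.toOpenPartialHomeomorph.symm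
        (tangentMap J (I.prod 𝓘(ℝ, F)) (fun x => ((f x).proj, (e (f x)).2)) ⟨n, v⟩) :=
        tangentMap_comp_at (I' := I.prod 𝓘(ℝ, F)) ⟨n, v⟩
          (mdifferentiableAt_trivializationAt_symm hb) (h1.prodMk h2)
    _ = _ := congrArg (fun w : EM × F => tangentMap (I.prod 𝓘(ℝ, F)) (I.prod 𝓘(ℝ, F))
        e.toOpenPartialHomeomorph.symm ⟨((f n).proj, (e (f n)).2), w⟩) hm2

/-- Over a fixed `w`, the velocity depends only on the value and derivative of the coordinate curve
at `0`, so the curve may be replaced by its first-order approximation. -/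
lemma velocity_tangentLift {x₀ : M} {w : TangentBundle I M}
    (hw : w.proj ∈ (trivializationAt F V x₀).baseSet) {c : ℝ → F × F} {c' : F × F}
    (hc : HasDerivAt c c' 0) :
    velocity (fun s => tangentLift F V x₀ w (c s)) =
      tangentMap 𝓘(ℝ, F × F) (I.prod 𝓘(ℝ, F)).tangent (tangentLift F V x₀ w) ⟨c 0, c'⟩ := by
  have h1 : MDifferentiableAt 𝓘(ℝ, F × F) (I.prod 𝓘(ℝ, F)).tangent (tangentLift F V x₀ w) (c 0) :=
    (contMDiff_tangentLift hw).mdifferentiable (by simp) (c 0)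
  have h2 : HasMFDerivAt 𝓘(ℝ, ℝ) 𝓘(ℝ, F × F) c 0 (ContinuousLinearMap.toSpanSingleton ℝ c') :=
    hc.hasFDerivAt.hasMFDerivAt
  have h3 : tangentMap 𝓘(ℝ, ℝ) 𝓘(ℝ, F × F) c ⟨0, 1⟩ = ⟨c 0, c'⟩ :=
    congrArg (fun x : F × F => (⟨c 0, x⟩ : TangentBundle 𝓘(ℝ, F × F) (F × F)))
      ((DFunLike.congr_fun h2.mfderiv (1 : ℝ)).trans (one_smul ℝ c'))
  refine (tangentMap_comp_at (I' := 𝓘(ℝ, F × F)) (g := tangentLift F V x₀ w) (f := c) ⟨0, 1⟩ h1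
    h2.mdifferentiableAt).trans ?_
  rw [h3]

/-- `tangentFibreCoord` is a smooth left inverse of `tangentLift`, so its tangent map recovers the
coordinate velocity `c'` from a vector in `T(TE)`. -/
lemma tangentMap_tangentFibreCoord_velocity {x₀ : M} {w : TangentBundle I M}
    (hw : w.proj ∈ (trivializationAt F V x₀).baseSet) {c : ℝ → F × F} {c' : F × F}
    (hc : HasDerivAt c c' 0) :
    tangentMap (I.prod 𝓘(ℝ, F)).tangent 𝓘(ℝ, F × F) (tangentFibreCoord x₀)
      (velocity (fun s => tangentLift F V x₀ w (c s))) = ⟨c 0, c'⟩ := by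
  rw [velocity_tangentLift hw hc]
  have h1 : MDifferentiableAt 𝓘(ℝ, F × F) (I.prod 𝓘(ℝ, F)).tangent (tangentLift F V x₀ w) (c 0) :=
    (contMDiff_tangentLift hw).mdifferentiable (by simp) (c 0)
  have hp : (tangentLift F V x₀ w (c 0)).proj.proj = w.proj :=
    (trivializationAt F V x₀).proj_symm_apply ((trivializationAt F V x₀).mem_target.2 hw)
  have h2 : MDifferentiableAt (I.prod 𝓘(ℝ, F)).tangent 𝓘(ℝ, F × F) (tangentFibreCoord x₀)
      (tangentLift F V x₀ w (c 0)) :=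
    (contMDiffAt_tangentFibreCoord (by rwa [hp])).mdifferentiableAt (by simp)
  refine (tangentMap_comp_at (I' := (I.prod 𝓘(ℝ, F)).tangent)
    (⟨c 0, c'⟩ : TangentBundle 𝓘(ℝ, F × F) (F × F)) h2 h1).symm.trans ?_
  have h3 : tangentFibreCoord x₀ ∘ tangentLift F V x₀ w = id :=
    funext fun d => tangentFibreCoord_tangentLift hw d
  rw [h3, tangentMap_id]
  rfl

end TangentCoordinates

/-! ### The vertical projection and the linearization. -/

section Linearization

variable {EM : Type*} [NormedAddCommGroup EM] [NormedSpace ℝ EM]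
  {HM : Type*} [TopologicalSpace HM] {I : ModelWithCorners ℝ EM HM}
  {M : Type*} [TopologicalSpace M] [ChartedSpace HM M]
  {F : Type*} [NormedAddCommGroup F] [NormedSpace ℝ F]
  {V : M → Type*} [TopologicalSpace (TotalSpace F V)]
  [∀ m, AddCommGroup (V m)] [∀ m, Module ℝ (V m)] [∀ m, TopologicalSpace (V m)]
  [FiberBundle F V] [VectorBundle ℝ F V] [IsManifold I ∞ M] [ContMDiffVectorBundle ∞ F V I]

lemma mdifferentiable_proj_proj :
    MDifferentiable ((I.prod 𝓘(ℝ, F)).prod 𝓘(ℝ, F)) I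
      (fun q : PullbackSpace I F V => q.proj.proj) := fun p =>
  MDifferentiableAt.comp (I' := I.prod 𝓘(ℝ, F)) (g := (TotalSpace.proj : TotalSpace F V → M)) p
    (mdifferentiableAt_proj V) (mdifferentiableAt_proj (PullbackFibre I F V))

lemma mdifferentiableAt_fibreCoord_fst {x₀ : M} {p : PullbackSpace I F V}
    (hp : p.proj.proj ∈ (trivializationAt F V x₀).baseSet) :
    MDifferentiableAt ((I.prod 𝓘(ℝ, F)).prod 𝓘(ℝ, F)) 𝓘(ℝ, F)
      (fun q : PullbackSpace I F V => (trivializationAt F V x₀ q.proj).2) p :=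
  MDifferentiableAt.comp (I' := I.prod 𝓘(ℝ, F))
    (g := fun q : TotalSpace F V => (trivializationAt F V x₀ q).2) p
    (mdifferentiableAt_fibreCoord hp) (mdifferentiableAt_proj (PullbackFibre I F V))

lemma mdifferentiable_pr₂ :
    MDifferentiable ((I.prod 𝓘(ℝ, F)).prod 𝓘(ℝ, F)) (I.prod 𝓘(ℝ, F)) (pr₂ I F V) := by
  intro p
  refine (mdifferentiableAt_totalSpace I (pr₂ I F V)).2 ⟨mdifferentiable_proj_proj p, ?_⟩
  have h1 : ContMDiffAt ((I.prod 𝓘(ℝ, F)).prod 𝓘(ℝ, F)) ((I.prod 𝓘(ℝ, F)).prod 𝓘(ℝ, F)) ∞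
      (trivializationAt F (PullbackFibre I F V) p.proj) p :=
    ((trivializationAt F (PullbackFibre I F V) p.proj).contMDiffOn
      (IB := I.prod 𝓘(ℝ, F)) (n := ∞)).contMDiffAt
      ((trivializationAt F (PullbackFibre I F V) p.proj).open_source.mem_nhds
        (FiberBundle.mem_trivializationAt_proj_source (x := p)))
  exact h1.snd.mdifferentiableAt (by simp)

lemma mdifferentiableAt_fibreCoord_snd {x₀ : M} {p : PullbackSpace I F V}
    (hp : p.proj.proj ∈ (trivializationAt F V x₀).baseSet) :
    MDifferentiableAt ((I.prod 𝓘(ℝ, F)).prod 𝓘(ℝ, F)) 𝓘(ℝ, F)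
      (fun q : PullbackSpace I F V => (trivializationAt F V x₀ (pr₂ I F V q)).2) p :=
  MDifferentiableAt.comp (I' := I.prod 𝓘(ℝ, F))
    (g := fun q : TotalSpace F V => (trivializationAt F V x₀ q).2) p
    (mdifferentiableAt_fibreCoord hp) (mdifferentiable_pr₂ p)

lemma hasMFDerivAt_fibreCoord_addSMul {x₀ : M} {p : PullbackSpace I F V}
    (hp : p.proj.proj ∈ (trivializationAt F V x₀).baseSet) (s : ℝ)
    {D₁ D₂ : (EM × F) × F →L[ℝ] F}
    (h₁ : HasMFDerivAt ((I.prod 𝓘(ℝ, F)).prod 𝓘(ℝ, F)) 𝓘(ℝ, F)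
      (fun q : PullbackSpace I F V => (trivializationAt F V x₀ q.proj).2) p D₁)
    (h₂ : HasMFDerivAt ((I.prod 𝓘(ℝ, F)).prod 𝓘(ℝ, F)) 𝓘(ℝ, F)
      (fun q : PullbackSpace I F V => (trivializationAt F V x₀ (pr₂ I F V q)).2) p D₂) :
    HasMFDerivAt ((I.prod 𝓘(ℝ, F)).prod 𝓘(ℝ, F)) 𝓘(ℝ, F)
      (fun q : PullbackSpace I F V => (trivializationAt F V x₀ (addSMul s q)).2) p
      (D₁ + s • D₂) := by
  refine (h₁.add (h₂.const_smul s)).congr_of_eventuallyEq ?_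
  filter_upwards [mdifferentiable_proj_proj.continuous.continuousAt
    ((trivializationAt F V x₀).open_baseSet.mem_nhds hp)] with q hq
  exact trivializationAt_add_smul hq _ _ s

lemma mdifferentiable_addSMul (s : ℝ) :
    MDifferentiable ((I.prod 𝓘(ℝ, F)).prod 𝓘(ℝ, F)) (I.prod 𝓘(ℝ, F))
      (addSMul s : PullbackSpace I F V → TotalSpace F V) := fun p =>
  (mdifferentiableAt_totalSpace I (addSMul s : PullbackSpace I F V → TotalSpace F V)).2
    ⟨mdifferentiable_proj_proj p, (hasMFDerivAt_fibreCoord_addSMul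
      (FiberBundle.mem_baseSet_trivializationAt' p.proj.proj) s
      (mdifferentiableAt_fibreCoord_fst
        (FiberBundle.mem_baseSet_trivializationAt' p.proj.proj)).hasMFDerivAt
      (mdifferentiableAt_fibreCoord_snd
        (FiberBundle.mem_baseSet_trivializationAt' p.proj.proj)).hasMFDerivAt).mdifferentiableAt⟩

/-- The second component of a pair `(v, w)` is recovered from its vertical lift. -/
lemma tangentMap_pr₂_eq_of_vertLift {x₀ : M}
    (u : TangentBundle ((I.prod 𝓘(ℝ, F)).prod 𝓘(ℝ, F)) (PullbackSpace I F V))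
    (hu : (vertLift u).proj.proj.proj ∈ (trivializationAt F V x₀).baseSet) :
    tangentMap ((I.prod 𝓘(ℝ, F)).prod 𝓘(ℝ, F)) (I.prod 𝓘(ℝ, F)) (pr₂ I F V) u =
      tangentLift F V x₀
        (tangentMap (I.prod 𝓘(ℝ, F)) I TotalSpace.proj (vertLift u).proj)
        (tangentMap (I.prod 𝓘(ℝ, F)).tangent 𝓘(ℝ, F × F) (tangentFibreCoord x₀)
          (vertLift u)).2 := by
  obtain ⟨p, u⟩ := u
  have hp : p.proj.proj ∈ (trivializationAt F V x₀).baseSet := hu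
  set w : TangentBundle I M :=
    tangentMap ((I.prod 𝓘(ℝ, F)).prod 𝓘(ℝ, F)) I (fun q : PullbackSpace I F V => q.proj.proj) ⟨p, u⟩
    with hw
  -- The foot point of the vertical lift is the curve at `s = 0`, and `a + 0 • b` lies over the same
  -- base point as `(a, b)`.
  have hbase : tangentMap (I.prod 𝓘(ℝ, F)) I TotalSpace.proj (vertLift ⟨p, u⟩).proj = w :=
    (tangentMap_comp_at (I' := I.prod 𝓘(ℝ, F)) (g := (TotalSpace.proj : TotalSpace F V → M))
      (f := (addSMul 0 : PullbackSpace I F V → TotalSpace F V)) ⟨p, u⟩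
      (mdifferentiableAt_proj V) (mdifferentiable_addSMul 0 p)).symm
  set y₁ : F := (trivializationAt F V x₀ p.proj).2
  set y₂ : F := (trivializationAt F V x₀ (pr₂ I F V p)).2
  set z₁ : F := mfderiv ((I.prod 𝓘(ℝ, F)).prod 𝓘(ℝ, F)) 𝓘(ℝ, F)
    (fun q : PullbackSpace I F V => (trivializationAt F V x₀ q.proj).2) p u
  set z₂ : F := mfderiv ((I.prod 𝓘(ℝ, F)).prod 𝓘(ℝ, F)) 𝓘(ℝ, F)
    (fun q : PullbackSpace I F V => (trivializationAt F V x₀ (pr₂ I F V q)).2) p u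
  have h2 : tangentMap ((I.prod 𝓘(ℝ, F)).prod 𝓘(ℝ, F)) (I.prod 𝓘(ℝ, F)) (pr₂ I F V) ⟨p, u⟩ =
      tangentLift F V x₀ w (y₂, z₂) :=
    tangentMap_eq_tangentLift (u := ⟨p, u⟩) (mdifferentiable_pr₂ p) hp
  -- In the trivialization the curve defining the vertical lift is a straight line whose slope is
  -- the vertical part of the second vector.
  have hs : ∀ s : ℝ, tangentMap ((I.prod 𝓘(ℝ, F)).prod 𝓘(ℝ, F)) (I.prod 𝓘(ℝ, F))
      (addSMul s : PullbackSpace I F V → TotalSpace F V) ⟨p, u⟩ =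
        tangentLift F V x₀ w ((y₁, z₁) + s • (y₂, z₂)) := by
    intro s
    refine (tangentMap_eq_tangentLift (u := ⟨p, u⟩) (mdifferentiable_addSMul s p) hp).trans
      (congrArg (tangentLift F V x₀ w) ?_)
    exact Prod.ext (trivializationAt_add_smul hp _ _ s)
      (DFunLike.congr_fun (hasMFDerivAt_fibreCoord_addSMul hp s
        (mdifferentiableAt_fibreCoord_fst hp).hasMFDerivAt
        (mdifferentiableAt_fibreCoord_snd hp).hasMFDerivAt).mfderiv u)
  have hc : HasDerivAt (fun s : ℝ => (y₁, z₁) + s • (y₂, z₂)) (y₂, z₂) 0 := by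
    simpa using ((hasDerivAt_id (0 : ℝ)).smul_const (y₂, z₂)).const_add (y₁, z₁)
  have hvl : vertLift (⟨p, u⟩ : TangentBundle ((I.prod 𝓘(ℝ, F)).prod 𝓘(ℝ, F))
      (PullbackSpace I F V)) =
      velocity fun s => tangentLift F V x₀ w ((y₁, z₁) + s • (y₂, z₂)) :=
    congrArg velocity (funext hs)
  have h3 := tangentMap_tangentFibreCoord_velocity (w := w) hp hc
  rw [← hvl] at h3
  rw [h2, hbase, h3]

/-- The vector chosen inside `vertProj` need not be `u`, but `T pr₂` of any preimage is a function
of the vertical lift alone, by `tangentMap_pr₂_eq_of_vertLift`. Full injectivity of the lift is not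
used. -/
lemma vertProj_vertLift
    (u : TangentBundle ((I.prod 𝓘(ℝ, F)).prod 𝓘(ℝ, F)) (PullbackSpace I F V)) :
    vertProj (vertLift u) =
      tangentMap ((I.prod 𝓘(ℝ, F)).prod 𝓘(ℝ, F)) (I.prod 𝓘(ℝ, F)) (pr₂ I F V) u := by
  have hX : ∃ u' : TangentBundle ((I.prod 𝓘(ℝ, F)).prod 𝓘(ℝ, F)) (PullbackSpace I F V),
      vertLift u' = vertLift u := ⟨u, rfl⟩
  have hb := FiberBundle.mem_baseSet_trivializationAt' (F := F) (E := V) (vertLift u).proj.proj.proj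
  rw [vertProj, dif_pos hX, tangentMap_pr₂_eq_of_vertLift u hb,
    tangentMap_pr₂_eq_of_vertLift hX.choose (by rw [hX.choose_spec]; exact hb), hX.choose_spec]

lemma Jet.push_add_smul_jet {m : M} (σ η : localSections I F V m) (s : ℝ) (v : TangentSpace I m) :
    (jet σ + s • jet η).push v =
      tangentMap I (I.prod 𝓘(ℝ, F)) (sectionMap F (σ.1 + s • η.1)) ⟨m, v⟩ := by
  rw [← map_smul, ← map_add]
  rfl

/-- Two sections of `π`, as a map into `π^*E`. -/
def pairMap (I : ModelWithCorners ℝ EM HM) (F : Type*) [NormedAddCommGroup F] [NormedSpace ℝ F]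
    {V : M → Type*} [TopologicalSpace (TotalSpace F V)] [∀ m, AddCommGroup (V m)]
    [∀ m, Module ℝ (V m)] [∀ m, TopologicalSpace (V m)] [FiberBundle F V] [VectorBundle ℝ F V]
    [IsManifold I ∞ M] [ContMDiffVectorBundle ∞ F V I] (σ η : ∀ m, V m) : M → PullbackSpace I F V :=
  fun x => ⟨⟨x, σ x⟩, η x⟩

lemma mdifferentiableAt_pairMap {m : M} (σ η : localSections I F V m) :
    MDifferentiableAt I ((I.prod 𝓘(ℝ, F)).prod 𝓘(ℝ, F)) (pairMap I F σ.1 η.1) m := by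
  refine (mdifferentiableAt_totalSpace (I.prod 𝓘(ℝ, F)) (pairMap I F σ.1 η.1)).2
    ⟨mdifferentiableAt_localSection σ, ?_⟩
  exact mdifferentiableAt_localRep (FiberBundle.mem_baseSet_trivializationAt' m) η

/-- The section `σ + sη` is `addSMul s` composed with the pair `(σ, η)`; the chain rule does the
rest. -/
lemma vertLift_tangentMap_pairMap {m : M} (σ η : localSections I F V m) (v : TangentSpace I m) :
    vertLift (tangentMap I ((I.prod 𝓘(ℝ, F)).prod 𝓘(ℝ, F)) (pairMap I F σ.1 η.1) ⟨m, v⟩) =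
      velocity fun s => (jet σ + s • jet η).push v := by
  refine congrArg velocity (funext fun s => ?_)
  rw [Jet.push_add_smul_jet]
  exact (tangentMap_comp_at (I' := (I.prod 𝓘(ℝ, F)).prod 𝓘(ℝ, F)) (g := addSMul s)
    (f := pairMap I F σ.1 η.1) ⟨m, v⟩ (mdifferentiable_addSMul s _)
    (mdifferentiableAt_pairMap σ η)).symm

lemma vertProj_velocity_push_add_smul {m : M} (j k : Jet I F V m) (v : TangentSpace I m) :
    vertProj (velocity fun s => (j + s • k).push v) = k.push v := by
  obtain ⟨σ, rfl⟩ := jet_surjective j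
  obtain ⟨η, rfl⟩ := jet_surjective k
  rw [← vertLift_tangentMap_pairMap, vertProj_vertLift]
  exact (tangentMap_comp_at (I' := (I.prod 𝓘(ℝ, F)).prod 𝓘(ℝ, F)) (g := pr₂ I F V)
    (f := pairMap I F σ.1 η.1) ⟨m, v⟩ (mdifferentiable_pr₂ _) (mdifferentiableAt_pairMap σ η)).symm

variable [I.Boundaryless]

/-- The coordinate form `(y, Γ ẋ)` of a horizontal lift, which turns curves of jets into curves in
`F × F` over a fixed tangent vector. -/
lemma Jet.push_eq_tangentLift {m : M} (j : Jet I F V m) (v : TangentSpace I m) :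
    j.push v = tangentLift F V m ⟨m, v⟩ ((j.coord m).1,
      (j.coord m).2 (mfderiv I 𝓘(ℝ, EM) (extChartAt I m) m v)) := by
  obtain ⟨σ, rfl⟩ := jet_surjective j
  have hb := FiberBundle.mem_baseSet_trivializationAt' (F := F) (E := V) m
  have hs := mem_chart_source HM m
  refine (tangentMap_eq_tangentLift (u := ⟨m, v⟩) (mdifferentiableAt_localSection σ) hb).trans ?_
  rw [coord_jet hs hb, ← localDeriv_eq_fderiv_chartRep hs hb]
  have h1 : tangentMap I I (fun x => (sectionMap F σ.1 x).proj) (⟨m, v⟩ : TangentBundle I M) =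
      ⟨m, v⟩ :=
    congrFun (tangentMap_id (I := I) (M := M)) ⟨m, v⟩
  rw [h1]
  rfl

/-- In coordinates, applying a jet to `v` is a continuous linear map. A curve of jets and its
first-order Taylor expansion thus give coordinate curves with equal value and derivative at `0`,
hence equal velocities in `TE`. -/
lemma velocity_push {m : M} {j : ℝ → Jet I F V m} {k : Jet I F V m}
    (hj : HasDerivAt (fun s => (j s).coord m) (k.coord m) 0) (v : TangentSpace I m) :
    velocity (fun s => (j s).push v) = velocity fun s => (j 0 + s • k).push v := by
  have hb := FiberBundle.mem_baseSet_trivializationAt' (F := F) (E := V) m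
  have hs := mem_chart_source HM m
  set v' : EM := mfderiv I 𝓘(ℝ, EM) (extChartAt I m) m v
  have hl : ∀ {f : ℝ → F × (EM →L[ℝ] F)} {f' : F × (EM →L[ℝ] F)}, HasDerivAt f f' 0 →
      HasDerivAt (fun s => ((f s).1, (f s).2 v')) (f'.1, f'.2 v') 0 := by
    intro f f' hf
    exact (((ContinuousLinearMap.fst ℝ F (EM →L[ℝ] F)).prod
      ((ContinuousLinearMap.apply ℝ F v').comp
        (ContinuousLinearMap.snd ℝ F (EM →L[ℝ] F)))).hasFDerivAt (x := f 0)).comp_hasDerivAt 0 hf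
  have hk : HasDerivAt (fun s : ℝ => (j 0 + s • k).coord m) (k.coord m) 0 := by
    simp only [Jet.coord_add_smul hs hb]
    simpa using ((hasDerivAt_id (0 : ℝ)).smul_const (k.coord m)).const_add ((j 0).coord m)
  simp only [Jet.push_eq_tangentLift]
  refine (velocity_tangentLift (w := ⟨m, v⟩) hb (hl hj)).trans
    (Eq.trans ?_ (velocity_tangentLift (w := ⟨m, v⟩) hb (hl hk)).symm)
  show tangentMap _ _ _ (⟨_, _⟩ : TangentBundle 𝓘(ℝ, F × F) (F × F)) =
    tangentMap _ _ _ (⟨(((j 0 + (0 : ℝ) • k).coord m).1, ((j 0 + (0 : ℝ) • k).coord m).2 v'), _⟩ :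
      TangentBundle 𝓘(ℝ, F × F) (F × F))
  rw [zero_smul, add_zero]

namespace Connection

variable (h : Connection I F V)

lemma linB_eq_push (p : PullbackSpace I F V) (w : TangentSpace (I.prod 𝓘(ℝ, F)) p.proj) :
    h.linB p w = (h.fibreDerivJet (m := p.proj.proj) p.proj.2 p.2).push
      (mfderiv (I.prod 𝓘(ℝ, F)) I TotalSpace.proj p.proj w) := by
  refine Eq.trans (congrArg vertProj (velocity_push (h.hasDerivAt_coord_toFun
    (mem_chart_source HM p.proj.proj) (FiberBundle.mem_baseSet_trivializationAt' p.proj.proj)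
    p.proj.2 p.2) _)) ?_
  exact vertProj_velocity_push_add_smul _ _ _

/-- For `η` representing the fibre derivative, the horizontal lift is `T(ιη)(w)`. Both components
follow from the chain rule, since `pr₁ ∘ ιη` is the identity and `pr₂ ∘ ιη = η ∘ π`. -/
lemma isLinearization_pullbackDeriv : h.IsLinearization h.pullbackDeriv := by
  intro p w
  obtain ⟨η, hη⟩ := jet_surjective (h.fibreDerivJet (m := p.proj.proj) p.proj.2 p.2)
  have hlift : h.pullbackDeriv.horLift p.2 w =
      tangentMap (I.prod 𝓘(ℝ, F)) ((I.prod 𝓘(ℝ, F)).prod 𝓘(ℝ, F))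
        (sectionMap F (pullbackLocalSection I F V p.proj η).1) ⟨p.proj, w⟩ := by
    show (canonicalImmersion I F V p.proj (h.fibreDerivJet (m := p.proj.proj) p.proj.2 p.2)).push w
      = _
    rw [← hη]
    rfl
  have hd := mdifferentiableAt_localSection (pullbackLocalSection I F V p.proj η)
  rw [hlift, linB_eq_push, ← hη, Jet.push_jet]
  constructor
  · refine (tangentMap_comp_at (I' := (I.prod 𝓘(ℝ, F)).prod 𝓘(ℝ, F))
      (g := (TotalSpace.proj : PullbackSpace I F V → TotalSpace F V)) ⟨p.proj, w⟩
      (mdifferentiableAt_proj (PullbackFibre I F V)) hd).symm.trans ?_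
    exact congrFun (tangentMap_id (I := I.prod 𝓘(ℝ, F)) (M := TotalSpace F V)) ⟨p.proj, w⟩
  · refine (tangentMap_comp_at (I' := (I.prod 𝓘(ℝ, F)).prod 𝓘(ℝ, F))
      (g := pr₂ I F V) ⟨p.proj, w⟩ (mdifferentiable_pr₂ _) hd).symm.trans ?_
    exact tangentMap_comp_at (I' := I) (g := sectionMap F η.1)
      (f := (TotalSpace.proj : TotalSpace F V → M)) ⟨p.proj, w⟩
      (mdifferentiableAt_localSection η) (mdifferentiableAt_proj V)

end Connection

end Linearization

end NonlinearConnection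

theorem theorem7p2
    {EM : Type*} [NormedAddCommGroup EM] [NormedSpace ℝ EM] [CompleteSpace EM]
    {HM : Type*} [TopologicalSpace HM] {I : ModelWithCorners ℝ EM HM} [I.Boundaryless]
    {M : Type*} [TopologicalSpace M] [ChartedSpace HM M] [IsManifold I ∞ M]
    {F : Type*} [NormedAddCommGroup F] [NormedSpace ℝ F] [CompleteSpace F]
    {V : M → Type*} [TopologicalSpace (TotalSpace F V)]
    [∀ m, AddCommGroup (V m)] [∀ m, Module ℝ (V m)] [∀ m, TopologicalSpace (V m)]
    [FiberBundle F V] [VectorBundle ℝ F V] [ContMDiffVectorBundle ∞ F V I]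
    (h : NonlinearConnection.Connection I F V) :
    ∃ hbar : NonlinearConnection.Connection (I.prod 𝓘(ℝ, F)) F (NonlinearConnection.PullbackFibre I F V),
      hbar.toMap = NonlinearConnection.jetMap ∘ NonlinearConnection.fibreDeriv h.toFun ∧
      h.IsLinearization hbar ∧
      hbar.IsLinear :=
  ⟨h.pullbackDeriv, h.toMap_pullbackDeriv, h.isLinearization_pullbackDeriv, h.isLinear_pullbackDeriv⟩
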